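/- **The game.** In the $n$-round parallel repeated Magic Square game Alice and Bob receive independent uniformly random $\vec r,\vec c\in\{0,1,2\}^n$. Alice answers $(\vec a_0,\vec a_1)$ and Bob $(\vec b_0,\vec b_1)$, all in $\{0,1\}^n$. Put $\vec a_2=\vec a_0+\vec a_1$ and $\vec b_2=\vec 1+\vec b_0+\vec b_1$ (mod 2). They win iff $(\vec a_{c_k})_k=(\vec b_{r_k})_k$ for every round $k$. An entangled strategy consists of a unit vector $|\psi\rangle$ in a complex Hilbert space $\mathcal H$ and, for all questions, complete projective measurements $\{P_{\vec r}^{\vec a_0,\vec a_1}\}$ of Alice and $\{Q_{\vec c}^{\vec b_0,\vec b_1}\}$ of Bob on $\mathcal H$, Alice's operators commuting with Bob's (for instance $\mathcal H=\mathcal H_A\otimes\mathcal H_B$, Alice acting on $\mathcal H_A$ and Bob on $\mathcal H_B$). **The isometry.** For every round $k$ adjoin to Alice a register with orthonormal basis $|\rho\rangle$, $\rho\in\{0,1,2\}^{[n]\setminus\{k\}}$, in the uniform superposition state, and likewise to Bob; let $|\psi'\rangle\in\mathcal H'$ be $|\psi\rangle$ together with these $2n$ ancillas. Define on $\mathcal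 H'$ the observables $$\tilde A^c_{r,k}=\sum_{\vec r:\,r_k=r}\ \sum_{\vec a_0,\vec a_1}(-1)^{(\vec a_c)_k}P_{\vec r}^{\vec a_0,\vec a_1}\otimes|\vec r_{-k}\rangle\langle\vec r_{-k}|,\qquad \tilde B^r_{c,k}=\sum_{\vec c:\,c_k=c}\ \sum_{\vec b_0,\vec b_1}(-1)^{(\vec b_r)_k}Q_{\vec c}^{\vec b_0,\vec b_1}\otimes|\vec c_{-k}\rangle\langle\vec c_{-k}|,$$ where the projectors $|\vec r_{-k}\rangle\langle\vec r_{-k}|$ and $|\vec c_{-k}\rangle\langle\vec c_{-k}|$ act on Alice's, respectively Bob's, $k$-th ancilla register. Let $X_{2k-1}=\tilde A^1_{1,k}$, $X_{2k}=\tilde A^0_{1,k}$, $Z_{2k-1}=\tilde A^0_{0,k}$, $Z_{2k}=\tilde A^1_{0,k}$ and $X^B_{2k-1}=\tilde B^1_{1,k}$, $X^B_{2k}=\tilde B^1_{0,k}$, $Z^B_{2k-1}=\tilde B^0_{0,k}$, $Z^B_{2k}=\tilde B^0_{1,k}$. For $a,b\in\{0,1\}^{2n}$ let $W^A_{a,b}=\prod_{i=1}^{2n}X_i^{a_i}\prod_{i=1}^{2n}Z_i^{b_i}$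 and $W^B_{a,b}=\prod_{i=2n}^{1}(X^B_i)^{a_i}\prod_{i=2n}^{1}(Z^B_i)^{b_i}$, and let $V:\mathcal H'\to\mathcal H'\otimes((\mathbb C^2)^{\otimes 2n})^{\otimes 4}$, $$V|x\rangle=2^{-6n}\sum_{a,b,c,d,e,f\in\{0,1\}^{2n}}(-1)^{b\cdot(a+c)+e\cdot(d+f)}\,W^A_{a,b}W^B_{d,e}|x\rangle\otimes|a+c\rangle\otimes|c\rangle\otimes|d+f\rangle\otimes|f\rangle .$$ Number the output registers $1,\dots,5$, the first being $\mathcal H'$; registers 2 and 4 are the $2n$-qubit output registers of Alice and Bob, and registers 1, 3, 5 are junk. **Theorem.** There is a universal constant $C>0$ such that for all $n$, all $\varepsilon\ge 0$ and every strategy that wins the $n$-round parallel repeated Magic Square game with probability at least $1-\varepsilon$, the map $V$ is an isometry, and $|\phi\rangle=V|\psi'\rangle$ satisfies $$\langle\phi|\,\big(|\mathrm{EPR}\rangle\langle\mathrm{EPR}|^{\otimes 2n}\otimes I_{\mathrm{junk}}\big)\,|\phi\rangle\ \ge\ 1-C\,n^2\sqrt{\varepsilon},$$ where $|\mathrm{EPR}\rangle=(|00\rangle+|11\rangle)/\sqrt2$,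 and the $i$-th EPR pair is formed by the $i$-th qubits of registers 2 and 4. Moreover, for every $n$, the $4n$-qubit operator $$M_n=\Big(\tfrac12 IIII+\tfrac1{18}(IXIX+XIXI+XXXX+ZIZI+IZIZ+ZZZZ+XZXZ+ZXZX+YYYY)\Big)^{\otimes n},$$ where the four tensor factors of each copy are two qubits of Alice followed by the corresponding two qubits of Bob, has eigenvalue $1$ with eigenspace spanned by $|\mathrm{EPR}\rangle^{\otimes 2n}$, and every other eigenvalue of $M_n$ has absolute value at most $5/9$. -/

import Mathlib

open scoped Kronecker

noncomputable section

namespace MagicSquare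

/-! ### The game -/

/-- A question in the `n`-fold parallel repetition: a row (for Alice) or a column (for Bob)
of the square in every round. -/
abbrev Question (n : ℕ) := Fin n → Fin 3

/-- An answer: two `n`-bit strings. -/
abbrev Answer (n : ℕ) := (Fin n → ZMod 2) × (Fin n → ZMod 2)

/-- Alice's bit for column `c` in round `k`, where `a₂ = a₀ + a₁`. -/
def aliceBit {n : ℕ} (a : Answer n) (c : Fin 3) (k : Fin n) : ZMod 2 :=
  ![a.1 k, a.2 k, a.1 k + a.2 k] c

/-- Bob's bit for row `r` in round `k`, where `b₂ = 1 + b₀ + b₁`. -/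
def bobBit {n : ℕ} (b : Answer n) (r : Fin 3) (k : Fin n) : ZMod 2 :=
  ![b.1 k, b.2 k, 1 + b.1 k + b.2 k] r

/-- The players win when they win every round. -/
def Wins {n : ℕ} (r c : Question n) (a b : Answer n) : Prop :=
  ∀ k, aliceBit a (c k) k = bobBit b (r k) k

/-- An entangled strategy on the joint Hilbert space `H` of the two players: a unit vector, and
for every question a complete projective measurement of Alice (`P`) and of Bob (`Q`), acting on
`H`, such that Alice's operators commute with Bob's. In particular `H` may be the Hilbert
space tensor product of `H_A` and `H_B` (of any dimension), with measurements `P ⊗ 1` and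
`1 ⊗ Q`. -/
structure Strategy (n : ℕ) (H : Type*) [NormedAddCommGroup H] [InnerProductSpace ℂ H]
    [CompleteSpace H] where
  state : H
  norm_state : ‖state‖ = 1
  P : Question n → Answer n → H →L[ℂ] H
  Q : Question n → Answer n → H →L[ℂ] H
  P_proj : ∀ r a, IsStarProjection (P r a)
  Q_proj : ∀ c b, IsStarProjection (Q c b)
  P_orth : ∀ r a a', a ≠ a' → P r a * P r a' = 0
  Q_orth : ∀ c b b', b ≠ b' → Q c b * Q c b' = 0
  P_sum : ∀ r, ∑ a, P r a = 1
  Q_sum : ∀ c, ∑ b, Q c b = 1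
  comm : ∀ r a c b, Commute (P r a) (Q c b)

/-! ### Hilbert spaces with registers -/

/-- The Hilbert space `E ⊗ ℂ^ι`, for a finite set `ι` of basis labels. -/
abbrev Ext (ι : Type*) (E : Type*) := PiLp 2 (fun _ : ι => E)

section Ext

variable {ι : Type*} [Fintype ι] {E : Type*} [NormedAddCommGroup E] [InnerProductSpace ℂ E]

/-- The controlled operator `∑ i, T i ⊗ |i⟩⟨i|` on `E ⊗ ℂ^ι`. -/
def controlled (T : ι → E →L[ℂ] E) : Ext ι E →L[ℂ] Ext ι E :=
  (PiLp.continuousLinearEquiv 2 ℂ (fun _ : ι => E)).symm.toContinuousLinearMap ∘L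
    (ContinuousLinearMap.pi fun i => T i ∘L ContinuousLinearMap.proj i) ∘L
      (PiLp.continuousLinearEquiv 2 ℂ (fun _ : ι => E)).toContinuousLinearMap

/-- The map `x ↦ x ⊗ |i⟩`. -/
def tensorKet [DecidableEq ι] (i : ι) : E →L[ℂ] Ext ι E :=
  (PiLp.continuousLinearEquiv 2 ℂ (fun _ : ι => E)).symm.toContinuousLinearMap ∘L
    ContinuousLinearMap.single ℂ (fun _ : ι => E) i

end Ext

/-- The sign `(-1)^x`. -/
def sgn (x : ZMod 2) : ℂ := (-1) ^ x.val

/-- Basis labels of one player's ancilla: for every round `k`, a register `ℂ^(3^(n-1))` whose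
basis is labelled by the possible questions in the rounds other than `k`. -/
abbrev Anc (n : ℕ) := (k : Fin n) → ({j : Fin n // j ≠ k} → Fin 3)

/-- The question that is `q` in round `k` and `ρ` in the other rounds. -/
def glue {n : ℕ} (k : Fin n) (q : Fin 3) (ρ : {j : Fin n // j ≠ k} → Fin 3) : Question n :=
  fun j => if h : j = k then q else ρ ⟨j, h⟩

/-- Basis labels of `2n` qubits. -/
abbrev Qubits (n : ℕ) := Fin (2 * n) → ZMod 2

/-- The space `H'` of the strategy together with the ancillas of Alice and of Bob. -/
abbrev Dilated (n : ℕ) (H : Type*) := Ext (Anc n × Anc n) H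

/-- The output space `H' ⊗ (ℂ²)^{⊗2n} ⊗ (ℂ²)^{⊗2n} ⊗ (ℂ²)^{⊗2n} ⊗ (ℂ²)^{⊗2n}` of the isometry.
The four groups of qubits are: Alice's output, Alice's junk, Bob's output, Bob's junk. -/
abbrev Output (n : ℕ) (H : Type*) :=
  Ext (Qubits n × Qubits n × Qubits n × Qubits n) (Dilated n H)

/-- The round to which qubit `i` belongs (qubits and rounds are numbered from zero, and round `k`
has the qubits `2k` and `2k+1`). -/
def round {n : ℕ} (i : Fin (2 * n)) : Fin n := ⟨i.val / 2, by omega⟩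

/-! ### Target state and ideal test -/

/-- The amplitudes of an EPR pair `(|00⟩ + |11⟩)/√2`. -/
def epr (x y : ZMod 2) : ℂ := if x = y then ((√2)⁻¹ : ℝ) else 0

/-- The amplitudes of `2n` EPR pairs, the `i`-th one being shared between the `i`-th qubit of the
first factor and the `i`-th qubit of the second factor. -/
def eprState (n : ℕ) : Qubits n × Qubits n → ℂ := fun z => ∏ i, epr (z.1 i) (z.2 i)

/-- The projector onto `2n` EPR pairs. -/
def eprProj (n : ℕ) : Matrix (Qubits n × Qubits n) (Qubits n × Qubits n) ℂ :=
  Matrix.vecMulVec (eprState n) (star (eprState n))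

def σX : Matrix (ZMod 2) (ZMod 2) ℂ := (!![0, 1; 1, 0] : Matrix (Fin 2) (Fin 2) ℂ)

def σY : Matrix (ZMod 2) (ZMod 2) ℂ :=
  (!![0, -Complex.I; Complex.I, 0] : Matrix (Fin 2) (Fin 2) ℂ)

def σZ : Matrix (ZMod 2) (ZMod 2) ℂ := (!![1, 0; 0, -1] : Matrix (Fin 2) (Fin 2) ℂ)

/-- The four-qubit operator `S ⊗ T ⊗ S ⊗ T`. -/
def twice (S T : Matrix (ZMod 2) (ZMod 2) ℂ) :
    Matrix ((ZMod 2 × ZMod 2) × (ZMod 2 × ZMod 2)) ((ZMod 2 × ZMod 2) × (ZMod 2 × ZMod 2)) ℂ :=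
  (S ⊗ₖ T) ⊗ₖ (S ⊗ₖ T)

/-- The ideal test for one round. -/
def idealTestOne :
    Matrix ((ZMod 2 × ZMod 2) × (ZMod 2 × ZMod 2)) ((ZMod 2 × ZMod 2) × (ZMod 2 × ZMod 2)) ℂ :=
  (1 / 2 : ℂ) • 1 + (1 / 18 : ℂ) •
    (twice 1 σX + twice σX 1 + twice σX σX + twice σZ 1 + twice 1 σZ + twice σZ σZ +
      twice σX σZ + twice σZ σX + twice σY σY)

/-- The two qubits of round `k`. -/
def qubitsOf {n : ℕ} (x : Qubits n) (k : Fin n) : ZMod 2 × ZMod 2 :=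
  (x ⟨2 * k.val, by omega⟩, x ⟨2 * k.val + 1, by omega⟩)

/-- The ideal test `M_n`, the `n`-th tensor power of the ideal test for one round. -/
def idealTest (n : ℕ) : Matrix (Qubits n × Qubits n) (Qubits n × Qubits n) ℂ :=
  Matrix.of fun z w =>
    ∏ k, idealTestOne (qubitsOf z.1 k, qubitsOf z.2 k) (qubitsOf w.1 k, qubitsOf w.2 k)

/-- The operator `M ⊗ I_junk`, with `M` acting on the output qubits of Alice and Bob. -/
def actOnOutput {n : ℕ} {H : Type*} [NormedAddCommGroup H] [InnerProductSpace ℂ H]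
    (M : Matrix (Qubits n × Qubits n) (Qubits n × Qubits n) ℂ) (φ : Output n H) : Output n H :=
  WithLp.toLp 2 fun z => ∑ w : Qubits n × Qubits n,
    M (z.1, z.2.2.1) w • φ (w.1, z.2.1, w.2, z.2.2.2)

/-! ### Operators and isometry built from a strategy -/

namespace Strategy

variable {n : ℕ} {H : Type*} [NormedAddCommGroup H] [InnerProductSpace ℂ H] [CompleteSpace H]

open Classical in
/-- The probability of winning all `n` rounds on independent uniformly random questions. -/
def winProb (S : Strategy n H) : ℝ :=
  (∑ r : Question n, ∑ c : Question n, ∑ a : Answer n, ∑ b : Answer n,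
    if Wins r c a b then ‖S.P r a (S.Q c b S.state)‖ ^ 2 else 0) / (3 ^ n * 3 ^ n)

/-- Alice's observable on input `r` for her bit of round `k` in column `c`. -/
def aliceObs (S : Strategy n H) (r : Question n) (c : Fin 3) (k : Fin n) : H →L[ℂ] H :=
  ∑ a : Answer n, sgn (aliceBit a c k) • S.P r a

/-- Bob's observable on input `c` for his bit of round `k` in row `r`. -/
def bobObs (S : Strategy n H) (c : Question n) (r : Fin 3) (k : Fin n) : H →L[ℂ] H :=
  ∑ b : Answer n, sgn (bobBit b r k) • S.Q c b

/-- The state `ψ'`: the ancilla registers are in the uniform superposition of all basis states. -/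
def dilatedState (S : Strategy n H) : Dilated n H :=
  WithLp.toLp 2 fun _ => ((Fintype.card (Anc n) : ℂ))⁻¹ • S.state

/-- The dilated observable for row `r`, column `c` and round `k` on Alice's side: her questions
in the rounds other than `k` are read from her `k`-th ancilla register. -/
def aliceDilated (S : Strategy n H) (r c : Fin 3) (k : Fin n) : Dilated n H →L[ℂ] Dilated n H :=
  controlled fun α => S.aliceObs (glue k r (α.1 k)) c k

/-- The dilated observable for row `r`, column `c` and round `k` on Bob's side. -/
def bobDilated (S : Strategy n H) (r c : Fin 3) (k : Fin n) : Dilated n H →L[ℂ] Dilated n H :=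
  controlled fun α => S.bobObs (glue k c (α.2 k)) r k

/-- Alice's approximate Pauli `X` on qubit `i`. -/
def XA (S : Strategy n H) (i : Fin (2 * n)) : Dilated n H →L[ℂ] Dilated n H :=
  if i.val % 2 = 0 then S.aliceDilated 1 1 (round i) else S.aliceDilated 1 0 (round i)

/-- Alice's approximate Pauli `Z` on qubit `i`. -/
def ZA (S : Strategy n H) (i : Fin (2 * n)) : Dilated n H →L[ℂ] Dilated n H :=
  if i.val % 2 = 0 then S.aliceDilated 0 0 (round i) else S.aliceDilated 0 1 (round i)

/-- Bob's approximate Pauli `X` on qubit `i`. -/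
def XB (S : Strategy n H) (i : Fin (2 * n)) : Dilated n H →L[ℂ] Dilated n H :=
  if i.val % 2 = 0 then S.bobDilated 1 1 (round i) else S.bobDilated 1 0 (round i)

/-- Bob's approximate Pauli `Z` on qubit `i`. -/
def ZB (S : Strategy n H) (i : Fin (2 * n)) : Dilated n H →L[ℂ] Dilated n H :=
  if i.val % 2 = 0 then S.bobDilated 0 0 (round i) else S.bobDilated 0 1 (round i)

/-- `W^A_{a,b} = X^a Z^b`, with the products over the qubits in increasing order. -/
def WA (S : Strategy n H) (a b : Qubits n) : Dilated n H →L[ℂ] Dilated n H :=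
  (List.ofFn fun i => S.XA i ^ (a i).val).prod * (List.ofFn fun i => S.ZA i ^ (b i).val).prod

/-- `W^B_{d,e} = (X^B)^d (Z^B)^e`, with the products over the qubits in decreasing order. -/
def WB (S : Strategy n H) (d e : Qubits n) : Dilated n H →L[ℂ] Dilated n H :=
  (List.ofFn fun i => S.XB i ^ (d i).val).reverse.prod *
    (List.ofFn fun i => S.ZB i ^ (e i).val).reverse.prod

/-- The isometry
`V x = 2^{-6n} ∑_{a,b,c,d,e,f} (-1)^{b·(a+c)} (-1)^{e·(d+f)} W^A_{a,b} W^B_{d,e} x ⊗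
|a+c⟩ ⊗ |c⟩ ⊗ |d+f⟩ ⊗ |f⟩`. It is the composition of an isometry on Alice's side and one on
Bob's side. -/
def V (S : Strategy n H) : Dilated n H →L[ℂ] Output n H :=
  ((2 : ℂ) ^ (6 * n))⁻¹ • ∑ a : Qubits n, ∑ b : Qubits n, ∑ c : Qubits n,
    ∑ d : Qubits n, ∑ e : Qubits n, ∑ f : Qubits n,
      (sgn (b ⬝ᵥ (a + c)) * sgn (e ⬝ᵥ (d + f))) •
        (tensorKet (a + c, c, d + f, f) ∘L (S.WA a b * S.WB d e))

/-- The output state `φ = V ψ'`. -/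
def outputState (S : Strategy n H) : Output n H := S.V S.dilatedState

/-- The fidelity `⟨φ| (|EPR⟩⟨EPR|^{⊗2n} ⊗ I_junk) |φ⟩` of the output with `2n` EPR pairs. -/
def eprFidelity (S : Strategy n H) : ℝ :=
  (inner ℂ S.outputState (actOnOutput (eprProj n) S.outputState)).re

end Strategy

end MagicSquare

end

noncomputable section

namespace MagicSquare

/-! ### Words in operators that are approximately matched across two players -/

section Words

variable {E : Type*} [NormedAddCommGroup E] [NormedSpace ℂ E] {Λ : Type*}

/-! Winning all rounds forces, in each round, the two players' observables for the common cell of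
the square to agree on the state, with mean squared distance at most `4 * ε` over the questions. The
ancillas in uniform superposition turn this average into one estimate: the dilated observables of
the two players for a given cell differ by at most `6 * √ε` on ψ'. What remains is algebra of
isometries, each of Alice's commuting with each of Bob's, on one vector (`Matched`): an operator
adjacent to the vector may be exchanged for the other player's and then slid outwards. Hence a
relation of Alice's that holds approximately on ψ' also holds behind a word of hers, at a cost
linear in the length of that word (`Matched.suffix`).

The generators satisfy the Pauli relations on ψ' up to a multiple of `√ε`. Anticommutation is the
contradiction in the Magic Square: rows multiply to 1 for Alice, columns to -1 for Bob
(`dist_anticommutator_le`). Commutation between rounds holds because some fixed question to Bob has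
two exactly commuting observables that both match Alice's (`exists_bobFixed`). Reordering words of
length `2 * n` crosses quadratically many pairs of letters, whence the factor `n ^ 2`. By
`Matched.pauli_mul`, `W^A_{a,b} W^B_{d,e} ψ'` is then close to a sign times a vector depending only
on `a + d` and `b + e`.

The map `V` is a Fourier transform of the family of these vectors, and the squared norm of its value
is the mean of their squared norms (`norm_synth_sq`). So `V` is an isometry, and replacing each
vector by its ideal form costs no factor growing with the dimension. The ideal family is sent to a
vector fixed by the EPR projector (`synth_pauli`), and Pythagoras gives the fidelity.

The spectral statement is independent of this: products of Bell states diagonalize the test, its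
eigenvalues are products of the values for one round, and sixteen cases settle one round. -/

theorem isometry_one_clm : Isometry (1 : E →L[ℂ] E) := fun _ _ => rfl

theorem isometry_mul_clm {S T : E →L[ℂ] E} (hS : Isometry S) (hT : Isometry T) :
    Isometry (S * T) := hS.comp hT

theorem isometry_pow_clm {S : E →L[ℂ] E} (hS : Isometry S) (k : ℕ) : Isometry (S ^ k) := by
  induction k with
  | zero => simpa using isometry_one_clm
  | succ k ih => rw [pow_succ]; exact isometry_mul_clm ih hS

theorem isometry_list_prod {w : List (E →L[ℂ] E)} (hw : ∀ T ∈ w, Isometry T) :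
    Isometry w.prod := by
  induction w with
  | nil => simpa using isometry_one_clm
  | cons T w ih =>
    rw [List.prod_cons]
    exact isometry_mul_clm (hw T (by simp)) (ih fun S hS => hw S (by simp [hS]))

theorem dist_smul_of_norm_one {s : ℂ} (hs : ‖s‖ = 1) (x y : E) :
    dist (s • x) (s • y) = dist x y := by
  rw [dist_smul₀, hs, one_mul]

theorem commute_apply {S T : E →L[ℂ] E} (h : Commute S T) (x : E) : S (T x) = T (S x) :=
  congrArg (fun U : E →L[ℂ] E => U x) h.eq

theorem norm_list_prod_eq_one {w : List ℂ} (hw : ∀ z ∈ w, ‖z‖ = 1) : ‖w.prod‖ = 1 := by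
  induction w with
  | nil => simp
  | cons z w ih =>
    rw [List.prod_cons, norm_mul, hw z (by simp), ih fun y hy => hw y (by simp [hy]), one_mul]

/-- Two families of isometries, the first commuting with the second, whose actions on `ψ` differ
by at most `δ`. -/
structure Matched (A B : Λ → E →L[ℂ] E) (ψ : E) (δ : ℝ) : Prop where
  isoA : ∀ l, Isometry (A l)
  isoB : ∀ l, Isometry (B l)
  comm : ∀ l l', Commute (A l) (B l')
  close : ∀ l, dist (A l ψ) (B l ψ) ≤ δ

namespace Matched

variable {A B : Λ → E →L[ℂ] E} {ψ : E} {δ κ : ℝ}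

theorem isoWordA (h : Matched A B ψ δ) (w : List Λ) : Isometry (w.map A).prod :=
  isometry_list_prod fun T hT => by
    obtain ⟨l, -, rfl⟩ := List.mem_map.1 hT
    exact h.isoA l

theorem isoWordB (h : Matched A B ψ δ) (w : List Λ) : Isometry (w.map B).prod :=
  isometry_list_prod fun T hT => by
    obtain ⟨l, -, rfl⟩ := List.mem_map.1 hT
    exact h.isoB l

theorem commWord_left (h : Matched A B ψ δ) (w : List Λ) (l : Λ) :
    Commute (w.map A).prod (B l) :=
  Commute.list_prod_left _ _ fun T hT => by
    obtain ⟨l', -, rfl⟩ := List.mem_map.1 hT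
    exact h.comm l' l

theorem commWord_right (h : Matched A B ψ δ) (l : Λ) (w : List Λ) :
    Commute (A l) (w.map B).prod :=
  Commute.list_prod_right _ _ fun T hT => by
    obtain ⟨l', -, rfl⟩ := List.mem_map.1 hT
    exact h.comm l l'

theorem commWord (h : Matched A B ψ δ) (w v : List Λ) :
    Commute (w.map A).prod (v.map B).prod :=
  Commute.list_prod_right _ _ fun T hT => by
    obtain ⟨l', -, rfl⟩ := List.mem_map.1 hT
    exact h.commWord_left w l'

/-- A word of the first player may be transferred to the second player, in reverse order. -/
theorem transfer (h : Matched A B ψ δ) (w : List Λ) :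
    dist ((w.map A).prod ψ) ((w.reverse.map B).prod ψ) ≤ w.length * δ := by
  induction w with
  | nil => simp
  | cons l w ih =>
    have e1 : ((l :: w).map A).prod ψ = A l ((w.map A).prod ψ) := by simp
    have e2 : ((l :: w).reverse.map B).prod ψ = (w.reverse.map B).prod (B l ψ) := by simp
    -- The outermost letter is exchanged last: once the rest of the word belongs to the other
    -- player, `A l` slides through it down to `ψ`. This is the source of the reversal, and of the
    -- decreasing order in `WB`.
    have e3 : A l ((w.reverse.map B).prod ψ) = (w.reverse.map B).prod (A l ψ) :=
      commute_apply (h.commWord_right l _) ψ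
    calc _ ≤ dist (A l ((w.map A).prod ψ)) (A l ((w.reverse.map B).prod ψ)) +
          dist (A l ((w.reverse.map B).prod ψ)) (((l :: w).reverse.map B).prod ψ) := by
            rw [e1]; exact dist_triangle _ _ _
      _ ≤ w.length * δ + δ := by
        rw [(h.isoA l).dist_eq, e3, e2, (h.isoWordB _).dist_eq]
        exact add_le_add ih (h.close l)
      _ = _ := by push_cast [List.length_cons]; ring

/-- A relation that holds approximately on `ψ` still holds, up to the cost of transferring it,
after a word has been applied to `ψ`. -/
theorem suffix (h : Matched A B ψ δ) {S T : E →L[ℂ] E} (hS : Isometry S) (hT : Isometry T)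
    (hSB : ∀ l, Commute S (B l)) (hTB : ∀ l, Commute T (B l)) {s : ℂ} (hs : ‖s‖ = 1) {c : ℝ}
    (hST : dist (S ψ) (s • T ψ) ≤ c) (v : List Λ) :
    dist (S ((v.map A).prod ψ)) (s • T ((v.map A).prod ψ)) ≤ c + 2 * (v.length * δ) := by
  have hcomm : ∀ U : E →L[ℂ] E, (∀ l, Commute U (B l)) →
      U ((v.reverse.map B).prod ψ) = (v.reverse.map B).prod (U ψ) := fun U hU =>
    commute_apply (Commute.list_prod_right _ _ fun W hW => by
      obtain ⟨l', -, rfl⟩ := List.mem_map.1 hW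
      exact hU l') ψ
  have hv := h.transfer v
  calc _ ≤ dist (S ((v.map A).prod ψ)) (S ((v.reverse.map B).prod ψ)) +
        dist (S ((v.reverse.map B).prod ψ)) (s • T ((v.reverse.map B).prod ψ)) +
        dist (s • T ((v.reverse.map B).prod ψ)) (s • T ((v.map A).prod ψ)) :=
          dist_triangle4 _ _ _ _
    _ ≤ v.length * δ + c + v.length * δ := by
      rw [hS.dist_eq, dist_smul_of_norm_one hs, hT.dist_eq, hcomm S hSB, hcomm T hTB,
        ← map_smul, (h.isoWordB _).dist_eq, dist_comm _ ((v.map A).prod ψ)]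
      exact add_le_add (add_le_add hv hST) hv
    _ = _ := by ring

/-- A letter that approximately commutes up to signs with each letter of a word may be moved
across the word. -/
theorem pass (h : Matched A B ψ δ) (l : Λ) (s : Λ → ℂ) (w : List Λ) (hs : ∀ l', ‖s l'‖ = 1)
    (hl : ∀ l' ∈ w, dist (A l' (A l ψ)) (s l' • A l (A l' ψ)) ≤ κ) :
    dist ((w.map A).prod (A l ψ)) ((w.map s).prod • A l ((w.map A).prod ψ)) ≤
      w.length * (κ + 2 * δ) := by
  -- Induction from the right, since the hypothesis holds on `ψ` only. The letter adjacent to `ψ` is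
  -- crossed directly at cost `κ`; the others are crossed on `A l' ψ`, a suffix of length one that
  -- costs `2 * δ`.
  induction w using List.reverseRecOn with
  | nil => simp
  | append_singleton w l' ih =>
    have ih := ih fun l'' hl'' => hl l'' (by simp [hl''])
    have hl' := hl l' (by simp)
    have key := h.suffix (isometry_mul_clm (h.isoWordA w) (h.isoA l))
      (isometry_mul_clm (h.isoA l) (h.isoWordA w))
      (fun m => (h.commWord_left w m).mul_left (h.comm l m))
      (fun m => (h.comm l m).mul_left (h.commWord_left w m))
      (norm_list_prod_eq_one fun z hz => by
        obtain ⟨m, -, rfl⟩ := List.mem_map.1 hz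
        exact hs m) ih [l']
    have e1 : ((w ++ [l']).map A).prod (A l ψ) = (w.map A).prod (A l' (A l ψ)) := by simp
    have e2 : ((w ++ [l']).map s).prod • A l (((w ++ [l']).map A).prod ψ) =
        s l' • (w.map s).prod • A l ((w.map A).prod (A l' ψ)) := by
      simp [smul_smul, mul_comm]
    have key : dist ((w.map A).prod (A l (A l' ψ)))
        ((w.map s).prod • A l ((w.map A).prod (A l' ψ))) ≤
        w.length * (κ + 2 * δ) + 2 * δ := by simpa using key
    calc _ ≤ dist ((w.map A).prod (A l' (A l ψ))) (s l' • (w.map A).prod (A l (A l' ψ))) +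
          dist (s l' • (w.map A).prod (A l (A l' ψ)))
            (s l' • (w.map s).prod • A l ((w.map A).prod (A l' ψ))) := by
            rw [e1, e2]; exact dist_triangle _ _ _
      _ ≤ κ + (w.length * (κ + 2 * δ) + 2 * δ) := by
        rw [dist_smul_of_norm_one (hs l'), ← map_smul, (h.isoWordA w).dist_eq]
        exact add_le_add hl' key
      _ = _ := by push_cast [List.length_append, List.length_singleton]; ring

theorem pass_suffix (h : Matched A B ψ δ) (l : Λ) (s : Λ → ℂ) (w v : List Λ)
    (hs : ∀ l', ‖s l'‖ = 1)
    (hl : ∀ l' ∈ w, dist (A l' (A l ψ)) (s l' • A l (A l' ψ)) ≤ κ) :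
    dist ((w.map A).prod (A l ((v.map A).prod ψ)))
      ((w.map s).prod • A l ((w.map A).prod ((v.map A).prod ψ))) ≤
      w.length * (κ + 2 * δ) + 2 * (v.length * δ) :=
  h.suffix (isometry_mul_clm (h.isoWordA w) (h.isoA l))
    (isometry_mul_clm (h.isoA l) (h.isoWordA w))
    (fun m => (h.commWord_left w m).mul_left (h.comm l m))
    (fun m => (h.comm l m).mul_left (h.commWord_left w m))
    (norm_list_prod_eq_one fun z hz => by
      obtain ⟨m, -, rfl⟩ := List.mem_map.1 hz
      exact hs m) (h.pass l s w hs hl) v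

/-- Two words may be exchanged up to a sign. -/
theorem exchange (h : Matched A B ψ δ) (s : Λ → Λ → ℂ) (hs : ∀ l l', ‖s l l'‖ = 1)
    (w v : List Λ)
    (hl : ∀ l ∈ w, ∀ l' ∈ v, dist (A l' (A l ψ)) (s l l' • A l (A l' ψ)) ≤ κ) :
    dist ((v.map A).prod ((w.map A).prod ψ))
      ((w.map fun l => (v.map (s l)).prod).prod • (w.map A).prod ((v.map A).prod ψ)) ≤
      w.length * (v.length * (κ + 2 * δ) + 2 * (w.length * δ)) := by
  induction w with
  | nil => simp
  | cons l w ih =>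
    have ih := ih fun m hm => hl m (by simp [hm])
    have hδ : 0 ≤ δ := dist_nonneg.trans (h.close l)
    have hp := h.pass_suffix l (s l) v w (hs l) (hl l (by simp))
    have hn : ‖(v.map (s l)).prod‖ = 1 := norm_list_prod_eq_one fun z hz => by
      obtain ⟨m, -, rfl⟩ := List.mem_map.1 hz
      exact hs l m
    simp only [List.map_cons, List.prod_cons, mul_apply_eq_comp, List.length_cons]
    rw [← smul_smul, ← map_smul]
    refine (dist_triangle _ _ _).trans ((add_le_add hp
      (((dist_smul_of_norm_one hn _ _).trans ((h.isoA l).dist_eq _ _)).trans_le ih)).trans ?_)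
    push_cast
    nlinarith [mul_nonneg (Nat.cast_nonneg (α := ℝ) w.length) hδ]

end Matched

/-! ### Approximate Pauli operators -/

section Pauli

variable {ι : Type*}

/-- The word `∏ G i ^ x i`, in the order of the list. -/
def powWord (G : ι → E →L[ℂ] E) (L : List ι) (x : ι → ZMod 2) : E →L[ℂ] E :=
  (L.map fun i => G i ^ (x i).val).prod

theorem powWord_cons (G : ι → E →L[ℂ] E) (i : ι) (L : List ι) (x : ι → ZMod 2) :
    powWord G (i :: L) x = G i ^ (x i).val * powWord G L x := by
  simp [powWord]

theorem ZMod_two_eq (x : ZMod 2) : x = 0 ∨ x = 1 := by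
  revert x; decide

theorem pow_val_add {T : E →L[ℂ] E} (hT : T * T = 1) (x y : ZMod 2) :
    T ^ (x + y).val = T ^ x.val * T ^ y.val := by
  have h2 : (1 : ZMod 2) + 1 = 0 := by decide
  rcases ZMod_two_eq x with rfl | rfl <;> rcases ZMod_two_eq y with rfl | rfl <;>
    simp [h2, hT, ZMod.val_one]

theorem sgn_zero : sgn 0 = 1 := by simp [sgn]

theorem sgn_one : sgn 1 = -1 := by simp [sgn, ZMod.val_one]

theorem norm_sgn (x : ZMod 2) : ‖sgn x‖ = 1 := by simp [sgn]

theorem sgn_add (x y : ZMod 2) : sgn (x + y) = sgn x * sgn y := by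
  have h2 : (1 : ZMod 2) + 1 = 0 := by decide
  rcases ZMod_two_eq x with rfl | rfl <;> rcases ZMod_two_eq y with rfl | rfl <;>
    simp [h2, sgn_zero, sgn_one]

theorem sgn_mul_self (x : ZMod 2) : sgn x * sgn x = 1 := by
  rcases ZMod_two_eq x with rfl | rfl <;> simp [sgn_zero, sgn_one]

theorem sgn_sum {α : Type*} (s : Finset α) (f : α → ZMod 2) :
    sgn (∑ i ∈ s, f i) = ∏ i ∈ s, sgn (f i) := by
  classical
  induction s using Finset.induction_on with
  | empty => simp [sgn_zero]
  | insert a s ha ih => rw [Finset.sum_insert ha, Finset.prod_insert ha, sgn_add, ih]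

variable {G GB : ι → E →L[ℂ] E} {ψ : E} {δ κ : ℝ}

theorem Matched.pow (h : Matched G GB ψ δ) :
    Matched (fun p : ι × ZMod 2 => G p.1 ^ p.2.val) (fun p => GB p.1 ^ p.2.val) ψ δ where
  isoA p := isometry_pow_clm (h.isoA _) _
  isoB p := isometry_pow_clm (h.isoB _) _
  comm p q := (h.comm _ _).pow_pow _ _
  close p := by
    have h0 := dist_nonneg.trans (h.close p.1)
    obtain ⟨i, x⟩ := p
    rcases ZMod_two_eq x with rfl | rfl
    · simpa using h0
    · simpa [ZMod.val_one] using h.close i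

theorem powWord_eq (G : ι → E →L[ℂ] E) (L : List ι) (x : ι → ZMod 2) :
    powWord G L x =
      ((L.map fun i => (i, x i)).map fun p : ι × ZMod 2 => G p.1 ^ p.2.val).prod := by
  simp [powWord, Function.comp_def]

theorem Matched.isometry_powWord (h : Matched G GB ψ δ) (L : List ι) (x : ι → ZMod 2) :
    Isometry (powWord G L x) := by
  rw [powWord_eq]
  exact h.pow.isoWordA _

theorem Matched.isometry_powWordB (h : Matched G GB ψ δ) (L : List ι) (x : ι → ZMod 2) :
    Isometry (powWord GB L x) := by
  rw [powWord_eq]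
  exact h.pow.isoWordB _

theorem Matched.transfer_powWord (h : Matched G GB ψ δ) (L : List ι) (x : ι → ZMod 2) :
    dist (powWord G L x ψ) (powWord GB L.reverse x ψ) ≤ L.length * δ := by
  have := h.pow.transfer (L.map fun i => (i, x i))
  rw [powWord_eq, powWord_eq]
  simpa only [List.map_reverse, List.length_map] using this

theorem dist_pow_le {S T : E →L[ℂ] E} {s : ZMod 2} {κ : ℝ} (hκ : 0 ≤ κ) (ψ : E)
    (h : dist (S (T ψ)) (sgn s • T (S ψ)) ≤ κ) (x y : ZMod 2) :
    dist ((S ^ x.val) ((T ^ y.val) ψ)) (sgn (x * y * s) • (T ^ y.val) ((S ^ x.val) ψ)) ≤ κ := by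
  rcases ZMod_two_eq x with rfl | rfl <;> rcases ZMod_two_eq y with rfl | rfl <;>
    simp [sgn_zero, hκ, ZMod.val_one, h]

/-- Words in approximately commuting involutions multiply like exponents. -/
theorem Matched.merge (h : Matched G GB ψ δ) (hG : ∀ i, G i * G i = 1) (hκ : 0 ≤ κ)
    (hc : ∀ i j, dist (G i (G j ψ)) (G j (G i ψ)) ≤ κ) (L : List ι) (x y : ι → ZMod 2) :
    dist (powWord G L x (powWord G L y ψ)) (powWord G L (x + y) ψ) ≤
      L.length * (L.length * (κ + 4 * δ)) := by
  induction L with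
  | nil => simp [powWord]
  | cons i L ih =>
    have hδ : 0 ≤ δ := dist_nonneg.trans (h.close i)
    -- The letter `G i ^ y i` crosses the tail of the first word, with the tail of the second as
    -- suffix. It then meets `G i ^ x i`, and the two powers combine exactly.
    have hp := h.pow.pass_suffix (κ := κ) (i, y i) (fun _ => 1) (L.map fun i => (i, x i))
      (L.map fun i => (i, y i)) (by simp) (by
        intro l' _
        have := dist_pow_le (s := 0) hκ ψ (by simpa [sgn_zero] using hc l'.1 i) l'.2 (y i)
        simpa [sgn_zero] using this)
    simp only [← powWord_eq, List.length_map, List.map_const', List.prod_replicate, one_pow,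
      one_smul] at hp
    simp only [powWord_cons, mul_apply_eq_comp, List.length_cons, Pi.add_apply]
    rw [pow_val_add (hG i), mul_apply_eq_comp]
    have hi : Isometry (G i ^ (x i).val) := isometry_pow_clm (h.isoA i) _
    have hi' : Isometry (G i ^ (y i).val) := isometry_pow_clm (h.isoA i) _
    rw [hi.dist_eq]
    refine (dist_triangle _ _ _).trans
      ((add_le_add hp ((hi'.dist_eq _ _).trans_le ih)).trans ?_)
    push_cast
    nlinarith [mul_nonneg (Nat.cast_nonneg (α := ℝ) L.length) hδ,
      mul_nonneg (Nat.cast_nonneg (α := ℝ) L.length) hκ]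

theorem Matched.comp {Λ' : Type*} {A B : Λ → E →L[ℂ] E} (h : Matched A B ψ δ) (f : Λ' → Λ) :
    Matched (fun l => A (f l)) (fun l => B (f l)) ψ δ :=
  ⟨fun _ => h.isoA _, fun _ => h.isoB _, fun _ _ => h.comm _ _, fun _ => h.close _⟩

/-- Approximate Pauli words of the two players multiply on `ψ` as Pauli operators do. The
letters `(true, i)` are the operators `X i`, the letters `(false, i)` the operators `Z i`. -/
theorem Matched.pauli_mul {m : ℕ} {G GB : Bool × Fin m → E →L[ℂ] E} (h : Matched G GB ψ δ)
    (hG : ∀ l, G l * G l = 1) (hκ : 0 ≤ κ)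
    (hc : ∀ t i j, dist (G (t, i) (G (t, j) ψ)) (G (t, j) (G (t, i) ψ)) ≤ κ)
    (hZX : ∀ i j, dist (G (false, i) (G (true, j) ψ))
      (sgn (if j = i then 1 else 0) • G (true, j) (G (false, i) ψ)) ≤ κ)
    (a b d e : Fin m → ZMod 2) :
    dist (powWord (fun i => G (true, i)) (List.finRange m) a
        (powWord (fun i => G (false, i)) (List.finRange m) b
          (powWord (fun i => GB (true, i)) (List.finRange m).reverse d
            (powWord (fun i => GB (false, i)) (List.finRange m).reverse e ψ))))
      (sgn (d ⬝ᵥ (b + e)) • powWord (fun i => GB (false, i)) (List.finRange m).reverse (b + e)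
        (powWord (fun i => G (true, i)) (List.finRange m) (a + d) ψ)) ≤
      3 * (m * δ) + 3 * (m * (m * (κ + 4 * δ))) := by
  have hX : Matched (fun i => G (true, i)) (fun i => GB (true, i)) ψ δ := h.comp _
  have hZ : Matched (fun i => G (false, i)) (fun i => GB (false, i)) ψ δ := h.comp _
  have cZX : ∀ x y, Commute (powWord (fun i => G (false, i)) (List.finRange m) x)
      (powWord (fun i => GB (true, i)) (List.finRange m).reverse y) := fun x y =>
    Commute.list_prod_left _ _ fun T hT => Commute.list_prod_right _ _ fun T' hT' => by
      obtain ⟨i, -, rfl⟩ := List.mem_map.1 hT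
      obtain ⟨j, -, rfl⟩ := List.mem_map.1 hT'
      exact (h.comm _ _).pow_pow _ _
  have cXZ : ∀ x y, Commute (powWord (fun i => G (true, i)) (List.finRange m) x)
      (powWord (fun i => GB (false, i)) (List.finRange m).reverse y) := fun x y =>
    Commute.list_prod_left _ _ fun T hT => Commute.list_prod_right _ _ fun T' hT' => by
      obtain ⟨i, -, rfl⟩ := List.mem_map.1 hT
      obtain ⟨j, -, rfl⟩ := List.mem_map.1 hT'
      exact (h.comm _ _).pow_pow _ _
  have tX := hX.transfer_powWord (List.finRange m)
  have tZ := hZ.transfer_powWord (List.finRange m)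
  have mX := hX.merge (fun _ => hG _) hκ (hc true) (List.finRange m)
  have mZ := hZ.merge (fun _ => hG _) hκ (hc false) (List.finRange m)
  have iX := hX.isometry_powWord (List.finRange m)
  have iZ := hZ.isometry_powWord (List.finRange m)
  have iXB := hX.isometry_powWordB (List.finRange m).reverse
  have iZB := hZ.isometry_powWordB (List.finRange m).reverse
  have ex : ∀ g d : Fin m → ZMod 2,
      dist (powWord (fun i => G (false, i)) (List.finRange m) g
          (powWord (fun i => G (true, i)) (List.finRange m) d ψ))
        (sgn (d ⬝ᵥ g) • powWord (fun i => G (true, i)) (List.finRange m) d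
          (powWord (fun i => G (false, i)) (List.finRange m) g ψ)) ≤
        m * (m * (κ + 4 * δ)) := by
    intro g d
    have := h.pow.exchange (κ := κ)
      (fun l l' => sgn (l'.2 * l.2 * if l.1.2 = l'.1.2 then 1 else 0)) (fun _ _ => norm_sgn _)
      ((List.finRange m).map fun i => ((true, i), d i))
      ((List.finRange m).map fun i => ((false, i), g i)) (by
        intro l hl l' hl'
        obtain ⟨j, -, rfl⟩ := List.mem_map.1 hl
        obtain ⟨i, -, rfl⟩ := List.mem_map.1 hl'
        exact dist_pow_le hκ ψ (hZX i j) (g i) (d j))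
    -- Only crossings of equal indices contribute a sign, so the total sign is the character of the
    -- dot product.
    have hs : (((List.finRange m).map fun i => (((true, i), d i) : (Bool × Fin m) × ZMod 2)).map
        fun l => ((((List.finRange m).map fun i =>
          (((false, i), g i) : (Bool × Fin m) × ZMod 2))).map fun l' =>
            sgn (l'.2 * l.2 * if l.1.2 = l'.1.2 then 1 else 0)).prod).prod = sgn (d ⬝ᵥ g) := by
      simp only [← List.ofFn_eq_map, List.map_ofFn, List.prod_ofFn, Function.comp_def]
      rw [dotProduct, sgn_sum]
      refine Finset.prod_congr rfl fun j _ => ?_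
      rw [← sgn_sum]
      simp [mul_comm]
    rw [hs] at this
    simp only [List.map_map, Function.comp_def, List.length_map, List.length_finRange] at this
    refine this.trans (le_of_eq ?_)
    ring
  simp only [List.length_finRange] at tX tZ mX mZ
  set L := List.finRange m
  set X := fun i => G (true, i)
  set Z := fun i => G (false, i)
  set XB := fun i => GB (true, i)
  set ZB := fun i => GB (false, i)
  have hsg : ‖sgn (d ⬝ᵥ (b + e))‖ = 1 := norm_sgn _
  -- Bob's letters are brought to Alice, where like letters merge and the X and Z words are
  -- exchanged; the Z word then returns to Bob. The steps `s1`, `s3`, `s5` are transfers at linear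
  -- cost; `s2`, `s6` (merging) and `s4` (exchange) have quadratic cost.
  have s1 : dist (powWord X L a (powWord Z L b (powWord XB L.reverse d (powWord ZB L.reverse e ψ))))
      (powWord X L a (powWord XB L.reverse d (powWord Z L b (powWord Z L e ψ)))) ≤ m * δ := by
    rw [← commute_apply (cZX b d), (iX a).dist_eq, (iZ b).dist_eq, (iXB d).dist_eq, dist_comm]
    exact tZ e
  have s2 : dist (powWord X L a (powWord XB L.reverse d (powWord Z L b (powWord Z L e ψ))))
      (powWord X L a (powWord XB L.reverse d (powWord Z L (b + e) ψ))) ≤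
      m * (m * (κ + 4 * δ)) := by
    rw [(iX a).dist_eq, (iXB d).dist_eq]
    exact mZ b e
  have s3 : dist (powWord X L a (powWord XB L.reverse d (powWord Z L (b + e) ψ)))
      (powWord X L a (powWord Z L (b + e) (powWord X L d ψ))) ≤ m * δ := by
    rw [← commute_apply (cZX _ d), (iX a).dist_eq, (iZ _).dist_eq, dist_comm]
    exact tX d
  have s4 : dist (powWord X L a (powWord Z L (b + e) (powWord X L d ψ)))
      (sgn (d ⬝ᵥ (b + e)) • powWord X L a (powWord X L d (powWord Z L (b + e) ψ))) ≤
      m * (m * (κ + 4 * δ)) := by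
    rw [← map_smul, (iX a).dist_eq]
    exact ex _ _
  have s5 : dist (sgn (d ⬝ᵥ (b + e)) • powWord X L a (powWord X L d (powWord Z L (b + e) ψ)))
      (sgn (d ⬝ᵥ (b + e)) • powWord ZB L.reverse (b + e) (powWord X L a (powWord X L d ψ))) ≤
      m * δ := by
    rw [dist_smul_of_norm_one hsg, ← commute_apply (cXZ a _), ← commute_apply (cXZ d _),
      (iX a).dist_eq, (iX d).dist_eq]
    exact tZ _
  have s6 : dist (sgn (d ⬝ᵥ (b + e)) •
        powWord ZB L.reverse (b + e) (powWord X L a (powWord X L d ψ)))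
      (sgn (d ⬝ᵥ (b + e)) • powWord ZB L.reverse (b + e) (powWord X L (a + d) ψ)) ≤
      m * (m * (κ + 4 * δ)) := by
    rw [dist_smul_of_norm_one hsg, (iZB _).dist_eq]
    exact mX a d
  have := (dist_triangle4 _ _ _ _).trans (add_le_add_three s1 s2 s3)
  have := (dist_triangle4 _ _ _ _).trans (add_le_add_three s4 s5 s6)
  refine (dist_triangle _ (powWord X L a (powWord Z L (b + e) (powWord X L d ψ))) _).trans ?_
  linarith

end Pauli
end Words
/-! ### Spectrum of the ideal test -/

section Spectrum

/-- The `x + y = s.1` Bell state with phase `s.2`, times `√2`. -/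
def bell (s z : ZMod 2 × ZMod 2) : ℂ := if z.1 + z.2 = s.1 then sgn (s.2 * z.1) else 0

theorem sum_zmod_two {M : Type*} [AddCommMonoid M] (f : ZMod 2 → M) : ∑ x, f x = f 0 + f 1 :=
  Fin.sum_univ_two f

/-- `S ⊗ S` is symmetric and has the Bell state `s` as an eigenvector, with eigenvalue `χ s`. -/
structure BellDiagonal (S : Matrix (ZMod 2) (ZMod 2) ℂ) (χ : ZMod 2 × ZMod 2 → ℂ) : Prop where
  symm : ∀ x x' y y', S x x' * S y y' = S x' x * S y' y
  eigen : ∀ s x y, ∑ x', ∑ y', S x x' * S y y' * bell s (x', y') = χ s * bell s (x, y)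

theorem bellDiagonal_one : BellDiagonal 1 fun _ => 1 := by
  constructor
  · intro x x' y y'
    simp [Matrix.one_apply, eq_comm]
  · intro s x y
    simp [Matrix.one_apply]

theorem bellDiagonal_X : BellDiagonal σX fun s => sgn s.2 := by
  have h00 : σX 0 0 = 0 := rfl
  have h01 : σX 0 1 = 1 := rfl
  have h10 : σX 1 0 = 1 := rfl
  have h11 : σX 1 1 = 0 := rfl
  have h2 : (1 : ZMod 2) + 1 = 0 := by decide
  constructor
  · intro x x' y y'
    rcases ZMod_two_eq x with rfl | rfl <;> rcases ZMod_two_eq x' with rfl | rfl <;>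
    rcases ZMod_two_eq y with rfl | rfl <;> rcases ZMod_two_eq y' with rfl | rfl <;>
      simp [h00, h01, h10, h11]
  · rintro ⟨p, q⟩ x y
    rcases ZMod_two_eq x with rfl | rfl <;> rcases ZMod_two_eq y with rfl | rfl <;>
    rcases ZMod_two_eq p with rfl | rfl <;> rcases ZMod_two_eq q with rfl | rfl <;>
      simp [sum_zmod_two, h00, h01, h10, h11, bell, sgn_zero, sgn_one, h2]

theorem bellDiagonal_Z : BellDiagonal σZ fun s => sgn s.1 := by
  have h00 : σZ 0 0 = 1 := rfl
  have h01 : σZ 0 1 = 0 := rfl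
  have h10 : σZ 1 0 = 0 := rfl
  have h11 : σZ 1 1 = -1 := rfl
  have h2 : (1 : ZMod 2) + 1 = 0 := by decide
  constructor
  · intro x x' y y'
    rcases ZMod_two_eq x with rfl | rfl <;> rcases ZMod_two_eq x' with rfl | rfl <;>
    rcases ZMod_two_eq y with rfl | rfl <;> rcases ZMod_two_eq y' with rfl | rfl <;>
      simp [h00, h01, h10, h11]
  · rintro ⟨p, q⟩ x y
    rcases ZMod_two_eq x with rfl | rfl <;> rcases ZMod_two_eq y with rfl | rfl <;>
    rcases ZMod_two_eq p with rfl | rfl <;> rcases ZMod_two_eq q with rfl | rfl <;>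
      simp [sum_zmod_two, h00, h01, h10, h11, bell, sgn_zero, sgn_one, h2]

/-- Since Y = iXZ, the tensor square of Y is minus the product of those of X and Z. Although `σY` is
antisymmetric, the two signs cancel in its tensor square. -/
theorem bellDiagonal_Y : BellDiagonal σY fun s => -(sgn s.1 * sgn s.2) := by
  have h00 : σY 0 0 = 0 := rfl
  have h01 : σY 0 1 = -Complex.I := rfl
  have h10 : σY 1 0 = Complex.I := rfl
  have h11 : σY 1 1 = 0 := rfl
  have h2 : (1 : ZMod 2) + 1 = 0 := by decide
  constructor
  · intro x x' y y'
    rcases ZMod_two_eq x with rfl | rfl <;> rcases ZMod_two_eq x' with rfl | rfl <;>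
    rcases ZMod_two_eq y with rfl | rfl <;> rcases ZMod_two_eq y' with rfl | rfl <;>
      simp [h00, h01, h10, h11]
  · rintro ⟨p, q⟩ x y
    rcases ZMod_two_eq x with rfl | rfl <;> rcases ZMod_two_eq y with rfl | rfl <;>
    rcases ZMod_two_eq p with rfl | rfl <;> rcases ZMod_two_eq q with rfl | rfl <;>
      simp [sum_zmod_two, h00, h01, h10, h11, bell, sgn_zero, sgn_one, h2]

theorem bell_complete (z z' : ZMod 2 × ZMod 2) :
    ∑ s, bell s z * bell s z' = if z = z' then 2 else 0 := by
  obtain ⟨x, y⟩ := z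
  obtain ⟨x', y'⟩ := z'
  have h2 : (1 : ZMod 2) + 1 = 0 := by decide
  rcases ZMod_two_eq x with rfl | rfl <;> rcases ZMod_two_eq y with rfl | rfl <;>
  rcases ZMod_two_eq x' with rfl | rfl <;> rcases ZMod_two_eq y' with rfl | rfl <;>
    simp [Fintype.sum_prod_type, sum_zmod_two, bell, sgn_zero, sgn_one, h2] <;> norm_num

/-- Labels of two qubits of Alice followed by two qubits of Bob. -/
abbrev Pairs := (ZMod 2 × ZMod 2) × (ZMod 2 × ZMod 2)

/-- The product of two Bell states on two qubits of Alice and two qubits of Bob. -/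
def bellTwo (s z : Pairs) : ℂ := bell s.1 (z.1.1, z.2.1) * bell s.2 (z.1.2, z.2.2)

theorem bellTwo_complete (z z' : Pairs) :
    ∑ s, bellTwo s z * bellTwo s z' = if z = z' then 4 else 0 := by
  have : ∀ s, bellTwo s z * bellTwo s z' = (bell s.1 (z.1.1, z.2.1) * bell s.1 (z'.1.1, z'.2.1)) *
      (bell s.2 (z.1.2, z.2.2) * bell s.2 (z'.1.2, z'.2.2)) := fun s => by
    simp only [bellTwo]; ring
  simp only [this]
  rw [Fintype.sum_prod_type]
  simp only [← Finset.mul_sum, ← Finset.sum_mul, bell_complete]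
  obtain ⟨⟨a, b⟩, c, d⟩ := z
  obtain ⟨⟨a', b'⟩, c', d'⟩ := z'
  simp only [Prod.mk.injEq]
  by_cases h1 : a = a' <;> by_cases h2 : b = b' <;> by_cases h3 : c = c' <;>
    by_cases h4 : d = d' <;> simp [h1, h2, h3, h4]
  norm_num

theorem twice_symm {S T χ χ'} (hS : BellDiagonal S χ) (hT : BellDiagonal T χ') (z w : Pairs) :
    twice S T z w = twice S T w z := by
  simp only [twice, Matrix.kroneckerMap_apply]
  linear_combination T z.1.2 w.1.2 * T z.2.2 w.2.2 * hS.symm z.1.1 w.1.1 z.2.1 w.2.1 +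
    S w.1.1 z.1.1 * S w.2.1 z.2.1 * hT.symm z.1.2 w.1.2 z.2.2 w.2.2

theorem twice_eigen {S T χ χ'} (hS : BellDiagonal S χ) (hT : BellDiagonal T χ') (s z : Pairs) :
    ∑ w, twice S T z w * bellTwo s w = χ s.1 * χ' s.2 * bellTwo s z := by
  have := congrArg₂ (· * ·) (hS.eigen s.1 z.1.1 z.2.1) (hT.eigen s.2 z.1.2 z.2.2)
  have e : χ s.1 * χ' s.2 * bellTwo s z = (χ s.1 * bell s.1 (z.1.1, z.2.1)) *
    (χ' s.2 * bell s.2 (z.1.2, z.2.2)) := by simp only [bellTwo]; ring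
  rw [e, ← this]
  simp only [Fintype.sum_prod_type, sum_zmod_two, twice, Matrix.kroneckerMap_apply, bellTwo]
  ring

/-- The eigenvalues of the ideal test for one round. -/
def testValue (s : Pairs) : ℝ :=
  let x₁ : ℝ := (-1) ^ s.1.2.val
  let z₁ : ℝ := (-1) ^ s.1.1.val
  let x₂ : ℝ := (-1) ^ s.2.2.val
  let z₂ : ℝ := (-1) ^ s.2.1.val
  1 / 2 + 1 / 18 * (x₂ + x₁ + x₁ * x₂ + z₁ + z₂ + z₁ * z₂ + x₁ * z₂ + z₁ * x₂ +
    (z₁ * x₁) * (z₂ * x₂))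

theorem idealTestOne_symm (z w : Pairs) : idealTestOne z w = idealTestOne w z := by
  have hX := bellDiagonal_X
  have hY := bellDiagonal_Y
  have hZ := bellDiagonal_Z
  have h1 := bellDiagonal_one
  simp only [idealTestOne, Matrix.add_apply, Matrix.smul_apply, Matrix.one_apply, eq_comm (a := z)]
  rw [twice_symm h1 hX, twice_symm hX h1, twice_symm hX hX, twice_symm hZ h1, twice_symm h1 hZ,
    twice_symm hZ hZ, twice_symm hX hZ, twice_symm hZ hX, twice_symm hY hY]

theorem idealTestOne_eigen (s z : Pairs) :
    ∑ w, idealTestOne z w * bellTwo s w = testValue s * bellTwo s z := by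
  have hX := bellDiagonal_X
  have hY := bellDiagonal_Y
  have hZ := bellDiagonal_Z
  have h1 := bellDiagonal_one
  simp only [idealTestOne, Matrix.add_apply, Matrix.smul_apply, Matrix.one_apply, smul_eq_mul,
    add_mul, mul_add, Finset.sum_add_distrib, mul_assoc, ← Finset.mul_sum]
  rw [twice_eigen h1 hX, twice_eigen hX h1, twice_eigen hX hX, twice_eigen hZ h1,
    twice_eigen h1 hZ, twice_eigen hZ hZ, twice_eigen hX hZ, twice_eigen hZ hX, twice_eigen hY hY]
  simp only [ite_mul, one_mul, zero_mul, Finset.sum_ite_eq, Finset.mem_univ, if_true, testValue, sgn]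
  push_cast
  ring

theorem testValue_zero : testValue 0 = 1 := by
  norm_num [testValue]

/-- The nine signs sum to 9 when all are +1. In the other fifteen cases the sum is 1 or -3, and the
value 1 gives 1/2 + 1/18 = 5/9. -/
theorem testValue_bounds (s : Pairs) : 0 ≤ testValue s ∧ testValue s ≤ 1 ∧
    (s ≠ 0 → testValue s ≤ 5 / 9) := by
  obtain ⟨⟨a, b⟩, c, d⟩ := s
  rcases ZMod_two_eq a with rfl | rfl <;> rcases ZMod_two_eq b with rfl | rfl <;>
  rcases ZMod_two_eq c with rfl | rfl <;> rcases ZMod_two_eq d with rfl | rfl <;>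
    norm_num [testValue, ZMod.val_one]

/-- Grouping qubits into rounds. -/
def roundEquiv (n : ℕ) : Qubits n × Qubits n ≃ (Fin n → Pairs) where
  toFun z k := (qubitsOf z.1 k, qubitsOf z.2 k)
  invFun f := (fun i => if i.val % 2 = 0 then (f (round i)).1.1 else (f (round i)).1.2,
    fun i => if i.val % 2 = 0 then (f (round i)).2.1 else (f (round i)).2.2)
  left_inv z := by
    have key : ∀ (x : Qubits n) (i : Fin (2 * n)),
        (if i.val % 2 = 0 then (qubitsOf x (round i)).1 else (qubitsOf x (round i)).2) = x i := by
      intro x i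
      simp only [qubitsOf, round]
      split_ifs with h <;> congr 1 <;> ext <;> simp only <;> omega
    ext i
    · exact key z.1 i
    · exact key z.2 i
  right_inv f := by
    have h1 : ∀ k : Fin n, (round ⟨2 * k.val, by omega⟩ : Fin n) = k := fun k => by
      ext; simp [round]
    have h2 : ∀ k : Fin n, (round ⟨2 * k.val + 1, by omega⟩ : Fin n) = k := fun k => by
      ext; simp only [round]; omega
    funext k
    simp only [qubitsOf, h1, h2]
    simp [Nat.add_mod]

/-- A product of Bell states. -/
def bellAll {n : ℕ} (s : Fin n → Pairs) (z : Qubits n × Qubits n) : ℂ :=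
  ∏ k, bellTwo (s k) (roundEquiv n z k)

theorem idealTest_symm {n : ℕ} (z w : Qubits n × Qubits n) : idealTest n z w = idealTest n w z := by
  simp only [idealTest, Matrix.of_apply]
  exact Finset.prod_congr rfl fun _ _ => idealTestOne_symm _ _

theorem idealTest_eigen {n : ℕ} (s : Fin n → Pairs) (z : Qubits n × Qubits n) :
    ∑ w, idealTest n z w * bellAll s w = (∏ k, testValue (s k) : ℝ) * bellAll s z := by
  calc ∑ w, idealTest n z w * bellAll s w
      = ∑ w, ∏ k, (idealTestOne (roundEquiv n z k) (roundEquiv n w k) *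
          bellTwo (s k) (roundEquiv n w k)) :=
        Finset.sum_congr rfl fun w _ => by
          rw [Finset.prod_mul_distrib]
          rfl
    _ = ∑ f : Fin n → Pairs, ∏ k, (idealTestOne (roundEquiv n z k) (f k) *
          bellTwo (s k) (f k)) := (roundEquiv n).sum_comp fun f : Fin n → Pairs =>
            ∏ k, (idealTestOne (roundEquiv n z k) (f k) * bellTwo (s k) (f k))
    _ = ∏ k, ∑ w, idealTestOne (roundEquiv n z k) w * bellTwo (s k) w :=
        (Fintype.prod_sum fun k w => idealTestOne (roundEquiv n z k) w * bellTwo (s k) w).symm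
    _ = _ := by
      simp only [idealTestOne_eigen, Finset.prod_mul_distrib, bellAll]
      push_cast
      rfl

theorem bellAll_complete {n : ℕ} (z z' : Qubits n × Qubits n) :
    ∑ s : Fin n → Pairs, bellAll s z * bellAll s z' = if z = z' then 4 ^ n else 0 := by
  simp only [bellAll, ← Finset.prod_mul_distrib]
  rw [← Fintype.prod_sum fun k s => bellTwo s (roundEquiv n z k) * bellTwo s (roundEquiv n z' k)]
  simp only [bellTwo_complete]
  split_ifs with h
  · simp [h]
  · obtain ⟨k, hk⟩ : ∃ k, roundEquiv n z k ≠ roundEquiv n z' k := by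
      by_contra! hk
      exact h ((roundEquiv n).injective (funext hk))
    exact Finset.prod_eq_zero (Finset.mem_univ k) (by simp [hk])

theorem prod_qubits {n : ℕ} (f : Fin (2 * n) → ℂ) :
    ∏ i, f i = ∏ k : Fin n, f ⟨2 * k.val, by omega⟩ * f ⟨2 * k.val + 1, by omega⟩ := by
  induction n with
  | zero => simp
  | succ n ih =>
    rw [Fin.prod_univ_castSucc (n := n)]
    have : ∏ i, f i = (∏ i : Fin (2 * n), f (i.castLE (by omega))) * f ⟨2 * n, by omega⟩ *
        f ⟨2 * n + 1, by omega⟩ :=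
      (Fin.prod_univ_castSucc (n := 2 * n + 1) f).trans (by
        rw [Fin.prod_univ_castSucc]; rfl)
    rw [this, ih, mul_assoc]
    rfl

theorem eprState_eq {n : ℕ} (z : Qubits n × Qubits n) : eprState n z = (2 ^ n)⁻¹ * bellAll 0 z := by
  have h : ∀ x y, epr x y = ((√2)⁻¹ : ℝ) * bell 0 (x, y) := fun x y => by
    have : x + y = 0 ↔ x = y := by revert x y; decide
    simp [epr, bell, this, sgn_zero]
  have h2 : (((√2)⁻¹ : ℝ) : ℂ) * ((√2)⁻¹ : ℝ) = 2⁻¹ := by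
    rw [← Complex.ofReal_mul, ← mul_inv, Real.mul_self_sqrt (by norm_num)]
    simp
  rw [eprState, prod_qubits, bellAll, ← inv_pow, ← Fin.prod_const, ← Finset.prod_mul_distrib]
  refine Finset.prod_congr rfl fun k _ => ?_
  rw [h, h, ← h2]
  simp only [bellTwo, roundEquiv, Equiv.coe_fn_mk, qubitsOf, Pi.zero_apply, Prod.fst_zero,
    Prod.snd_zero]
  ring

theorem prod_testValue_bound {n : ℕ} (s : Fin n → Pairs) (hs : s ≠ 0) :
    0 ≤ ∏ k, testValue (s k) ∧ ∏ k, testValue (s k) ≤ 5 / 9 := by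
  obtain ⟨k, hk⟩ := Function.ne_iff.1 hs
  refine ⟨Finset.prod_nonneg fun i _ => (testValue_bounds _).1, ?_⟩
  rw [← Finset.mul_prod_erase _ _ (Finset.mem_univ k)]
  have h1 : ∏ i ∈ Finset.univ.erase k, testValue (s i) ≤ 1 :=
    Finset.prod_le_one (fun i _ => (testValue_bounds _).1) fun i _ => (testValue_bounds _).2.1
  have h2 := (testValue_bounds (s k)).2.2 hk
  nlinarith [(testValue_bounds (s k)).1]

/-- The matrix is equal to its transpose, so the bilinear pairing with `bellAll s`, without
conjugation, can be evaluated with the test on either side. -/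
theorem idealTest_coeff {n : ℕ} {μ : ℂ} {v : Qubits n × Qubits n → ℂ}
    (hv : (idealTest n).mulVec v = μ • v) (s : Fin n → Pairs) :
    ((∏ k, testValue (s k) : ℝ) - μ) * ∑ z, bellAll s z * v z = 0 := by
  have h : ∑ z, bellAll s z * (idealTest n).mulVec v z =
      (∏ k, testValue (s k) : ℝ) * ∑ z, bellAll s z * v z := by
    simp only [Matrix.mulVec, dotProduct, Finset.mul_sum]
    rw [Finset.sum_comm]
    refine Finset.sum_congr rfl fun w _ => ?_
    have := congrArg (· * v w) (idealTest_eigen s w)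
    simp only [Finset.sum_mul] at this
    rw [← mul_assoc, ← this]
    exact Finset.sum_congr rfl fun z _ => by rw [idealTest_symm w z]; ring
  rw [hv] at h
  simp only [Pi.smul_apply, smul_eq_mul, mul_left_comm _ μ, ← Finset.mul_sum] at h
  rw [sub_mul, ← h, sub_self]

/-- Completeness alone gives the expansion; orthogonality of the Bell products is not needed. Each
Bell vector has squared norm 2 and there are two per round, whence `4 ^ n`. -/
theorem bellAll_expand {n : ℕ} (v : Qubits n × Qubits n → ℂ) (z : Qubits n × Qubits n) :
    4 ^ n * v z = ∑ s : Fin n → Pairs, (∑ w, bellAll s w * v w) * bellAll s z := by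
  simp only [Finset.sum_mul]
  rw [Finset.sum_comm]
  have : ∀ w, ∑ s : Fin n → Pairs, bellAll s w * v w * bellAll s z =
      (∑ s : Fin n → Pairs, bellAll s w * bellAll s z) * v w := fun w => by
    rw [Finset.sum_mul]
    exact Finset.sum_congr rfl fun s _ => by ring
  simp [this, bellAll_complete]

theorem idealTest_eigenspace (n : ℕ) :
    Module.End.eigenspace (Matrix.toLin' (idealTest n)) 1 = Submodule.span ℂ {eprState n} := by
  ext v
  rw [Module.End.mem_eigenspace_iff, Matrix.toLin'_apply, Submodule.mem_span_singleton]
  constructor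
  · intro hv
    refine ⟨(4 ^ n)⁻¹ * 2 ^ n * ∑ w, bellAll 0 w * v w, funext fun z => ?_⟩
    have hz := bellAll_expand v z
    rw [Finset.sum_eq_single 0 (fun s _ hs => ?_) (by simp)] at hz
    · rw [Pi.smul_apply, smul_eq_mul, eprState_eq]
      have h4 : (4 : ℂ) ^ n ≠ 0 := pow_ne_zero _ (by norm_num)
      have h2 : (2 : ℂ) ^ n ≠ 0 := pow_ne_zero _ (by norm_num)
      field_simp
      rw [hz]
    · have h := idealTest_coeff hv s
      rcases mul_eq_zero.1 h with h | h
      · have hb := (prod_testValue_bound s hs).2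
        rw [sub_eq_zero] at h
        have : (∏ k, testValue (s k) : ℝ) = 1 := by exact_mod_cast h
        linarith
      · rw [h, zero_mul]
  · rintro ⟨c, rfl⟩
    rw [Matrix.mulVec_smul, one_smul]
    congr 1
    funext z
    have h := idealTest_eigen 0 z
    simp only [Pi.zero_apply, testValue_zero, Finset.prod_const_one, Complex.ofReal_one,
      one_mul] at h
    simp only [Matrix.mulVec, dotProduct, eprState_eq, mul_left_comm _ ((2 : ℂ) ^ n)⁻¹,
      ← Finset.mul_sum, h]

theorem idealTest_eigenvalue (n : ℕ) (μ : ℂ)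
    (hμ : Module.End.HasEigenvalue (Matrix.toLin' (idealTest n)) μ) (h1 : μ ≠ 1) :
    ‖μ‖ ≤ 5 / 9 := by
  obtain ⟨v, hv⟩ := hμ.exists_hasEigenvector
  have hv' : (idealTest n).mulVec v = μ • v := by simpa using hv.apply_eq_smul
  obtain ⟨s, hs⟩ : ∃ s : Fin n → Pairs, ∑ w, bellAll s w * v w ≠ 0 := by
    by_contra! h
    refine hv.2 (funext fun z => ?_)
    have hz := bellAll_expand v z
    simpa [h] using hz
  have h := (mul_eq_zero.1 (idealTest_coeff hv' s)).resolve_right hs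
  rw [sub_eq_zero] at h
  have hs0 : s ≠ 0 := by
    rintro rfl
    simp [testValue_zero] at h
    exact h1 h.symm
  obtain ⟨h0, h5⟩ := prod_testValue_bound s hs0
  rw [← h, Complex.norm_real, Real.norm_of_nonneg h0]
  exact h5

end Spectrum
/-! ### Fourier analysis and the structure of the isometry -/

section Fourier

variable {E : Type*} [NormedAddCommGroup E] [InnerProductSpace ℂ E] {n m : ℕ}

theorem sum_sgn (b : Fin m → ZMod 2) :
    ∑ u : Fin m → ZMod 2, sgn (b ⬝ᵥ u) = if b = 0 then 2 ^ m else 0 := by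
  have : ∑ u : Fin m → ZMod 2, sgn (b ⬝ᵥ u) = ∏ i, ∑ x : ZMod 2, sgn (b i * x) := by
    rw [Fintype.prod_sum fun i x => sgn (b i * x)]
    simp only [dotProduct, sgn_sum]
  rw [this]
  split_ifs with h
  · simp [h, sgn_zero]
  · obtain ⟨i, hi⟩ := Function.ne_iff.1 h
    refine Finset.prod_eq_zero (Finset.mem_univ i) ?_
    rw [(ZMod_two_eq (b i)).resolve_left hi]
    simp [sum_zmod_two, sgn_zero, sgn_one]

theorem star_sgn (x : ZMod 2) : (starRingEnd ℂ) (sgn x) = sgn x := by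
  simp [sgn]

theorem add_self_bits (x : Fin m → ZMod 2) : x + x = 0 :=
  funext fun _ => CharTwo.add_self_eq_zero _

theorem add_eq_zero_bits {x y : Fin m → ZMod 2} : x + y = 0 ↔ x = y := by
  simp only [funext_iff, Pi.add_apply, Pi.zero_apply, CharTwo.add_eq_zero]

theorem parseval (f : (Fin m → ZMod 2) → E) :
    ∑ u : Fin m → ZMod 2, ‖∑ b, sgn (b ⬝ᵥ u) • f b‖ ^ 2 = 2 ^ m * ∑ b, ‖f b‖ ^ 2 := by
  have h : ∀ x : E, ((‖x‖ ^ 2 : ℝ) : ℂ) = inner ℂ x x := fun x => by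
    rw [inner_self_eq_norm_sq_to_K]; simp
  have key : ∑ u : Fin m → ZMod 2, inner ℂ (∑ b, sgn (b ⬝ᵥ u) • f b) (∑ b, sgn (b ⬝ᵥ u) • f b) =
      2 ^ m * ∑ b, inner ℂ (f b) (f b) := by
    simp only [sum_inner, inner_sum, inner_smul_left, inner_smul_right, star_sgn, Finset.mul_sum]
    rw [Finset.sum_comm]
    refine Finset.sum_congr rfl fun b _ => ?_
    rw [Finset.sum_comm]
    have : ∀ b', ∑ u : Fin m → ZMod 2, sgn (b ⬝ᵥ u) * (sgn (b' ⬝ᵥ u) * inner ℂ (f b') (f b)) =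
        (if b = b' then 2 ^ m else 0) * inner ℂ (f b') (f b) := fun b' => by
      simp only [← add_eq_zero_bits (x := b), ← sum_sgn, add_dotProduct, sgn_add, Finset.sum_mul,
        mul_assoc]
    simp [this]
  apply Complex.ofReal_injective
  push_cast
  simpa only [← h, Complex.ofReal_pow] using key

/-- The vector obtained by applying the Fourier transforms in the definition of `V` to a family
`F a b d e` of vectors in place of `W^A_{a,b} W^B_{d,e} x`. -/
def synth (F : Qubits n → Qubits n → Qubits n → Qubits n → E) :
    Ext (Qubits n × Qubits n × Qubits n × Qubits n) E :=
  WithLp.toLp 2 fun z => ((2 : ℂ) ^ (6 * n))⁻¹ • ∑ b, sgn (b ⬝ᵥ z.1) • ∑ e, sgn (e ⬝ᵥ z.2.2.1) •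
    F (z.1 + z.2.1) b (z.2.2.1 + z.2.2.2) e

theorem synth_sub (F F' : Qubits n → Qubits n → Qubits n → Qubits n → E) :
    synth F - synth F' = synth (F - F') := by
  ext z
  simp only [synth, PiLp.sub_apply, Pi.sub_apply, smul_sub, Finset.sum_sub_distrib]

/-- The Fourier sums over `b` and `e` contribute `2 ^ (2 * n)` each by `parseval`. With the squared
prefactor this leaves the reciprocal of the number of labels `(a, b, d, e)`, so the right side is a
mean. -/
theorem norm_synth_sq (F : Qubits n → Qubits n → Qubits n → Qubits n → E) :
    ‖synth F‖ ^ 2 = ((2 : ℝ) ^ (8 * n))⁻¹ * ∑ a, ∑ d, ∑ b, ∑ e, ‖F a b d e‖ ^ 2 := by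
  rw [PiLp.norm_sq_eq_of_L2]
  simp only [synth, norm_smul, mul_pow, Fintype.sum_prod_type, ← Finset.mul_sum]
  -- For fixed `u`, the translation `a = u + c` decouples the word label from the Fourier variable.
  have shift : ∀ g : Qubits n → Qubits n → ℝ, ∑ u, ∑ c, g u (u + c) = ∑ a, ∑ u, g u a := fun g => by
    rw [Finset.sum_comm (s := Finset.univ) (t := Finset.univ) (f := fun a u => g u a)]
    exact Finset.sum_congr rfl fun u _ => Equiv.sum_comp (Equiv.addLeft u) (g u)
  have e1 : ∀ u c, ∑ v : Qubits n, ∑ f : Qubits n, ‖∑ b, sgn (b ⬝ᵥ u) • ∑ e, sgn (e ⬝ᵥ v) •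
      F (u + c) b (v + f) e‖ ^ 2 =
      (fun u a => ∑ d, ∑ v : Qubits n, ‖∑ b, sgn (b ⬝ᵥ u) • ∑ e, sgn (e ⬝ᵥ v) • F a b d e‖ ^ 2)
        u (u + c) := fun u c =>
    shift fun v d => ‖∑ b, sgn (b ⬝ᵥ u) • ∑ e, sgn (e ⬝ᵥ v) • F (u + c) b d e‖ ^ 2
  simp only [e1]
  rw [shift fun u a => ∑ d, ∑ v : Qubits n,
    ‖∑ b, sgn (b ⬝ᵥ u) • ∑ e, sgn (e ⬝ᵥ v) • F a b d e‖ ^ 2]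
  have e2 : ∀ a, ∑ u : Qubits n, ∑ d, ∑ v : Qubits n,
      ‖∑ b, sgn (b ⬝ᵥ u) • ∑ e, sgn (e ⬝ᵥ v) • F a b d e‖ ^ 2 =
      ∑ d, 2 ^ (4 * n) * ∑ b, ∑ e, ‖F a b d e‖ ^ 2 := fun a => by
    rw [Finset.sum_comm]
    refine Finset.sum_congr rfl fun d _ => ?_
    rw [Finset.sum_comm]
    simp only [parseval]
    rw [← Finset.mul_sum, Finset.sum_comm]
    simp only [parseval, ← Finset.mul_sum]
    rw [← mul_assoc, ← pow_add]
    congr 2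
    ring
  simp only [e2, ← Finset.mul_sum]
  rw [← mul_assoc]
  congr 1
  rw [norm_inv, norm_pow, Complex.norm_ofNat, inv_pow, ← pow_mul]
  have h2 : (2 : ℝ) ^ (6 * n * 2) = 2 ^ (8 * n) * 2 ^ (4 * n) := by
    rw [← pow_add]; congr 1; ring
  rw [h2]
  field_simp

theorem norm_synth_sq_le (F : Qubits n → Qubits n → Qubits n → Qubits n → E) {η : ℝ}
    (hF : ∀ a b d e, ‖F a b d e‖ ^ 2 ≤ η) : ‖synth F‖ ^ 2 ≤ η := by
  rw [norm_synth_sq]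
  have : ∑ a, ∑ d, ∑ b, ∑ e, ‖F a b d e‖ ^ 2 ≤
      ∑ _a : Qubits n, ∑ _d : Qubits n, ∑ _b : Qubits n, ∑ _e : Qubits n, η := by
    gcongr with a _ d _ b _ e _
    exact hF a b d e
  refine (mul_le_mul_of_nonneg_left this (by positivity)).trans (le_of_eq ?_)
  simp only [Finset.sum_const, Finset.card_univ, Fintype.card_pi, ZMod.card, Finset.prod_const,
    Fintype.card_fin, nsmul_eq_mul]
  push_cast
  have h2 : (2 : ℝ) ^ (8 * n) = 2 ^ (2 * n) * (2 ^ (2 * n) * (2 ^ (2 * n) * 2 ^ (2 * n))) := by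
    rw [← pow_add, ← pow_add, ← pow_add]; congr 1; ring
  rw [h2]
  field_simp

theorem norm_synth_sq_of_const (F : Qubits n → Qubits n → Qubits n → Qubits n → E) {η : ℝ}
    (hF : ∀ a b d e, ‖F a b d e‖ ^ 2 = η) : ‖synth F‖ ^ 2 = η := by
  rw [norm_synth_sq]
  simp only [hF, Finset.sum_const, Finset.card_univ, Fintype.card_pi, ZMod.card,
    Finset.prod_const, Fintype.card_fin, nsmul_eq_mul]
  push_cast
  have h2 : (2 : ℝ) ^ (8 * n) = 2 ^ (2 * n) * (2 ^ (2 * n) * (2 ^ (2 * n) * 2 ^ (2 * n))) := by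
    rw [← pow_add, ← pow_add, ← pow_add]; congr 1; ring
  rw [h2]
  field_simp

/-- On a family that obeys the Pauli relations, the Fourier transforms produce a vector which is
supported on equal output qubits of Alice and Bob and does not depend on their value. -/
theorem synth_pauli (T : Qubits n → Qubits n → E) (u c v f : Qubits n) :
    synth (fun a b d e => sgn (d ⬝ᵥ (b + e)) • T (a + d) (b + e)) (u, c, v, f) =
      if u = v then ((2 : ℂ) ^ (4 * n))⁻¹ • ∑ g, sgn (g ⬝ᵥ f) • T (c + f) g else 0 := by
  -- With `g = b + e` the factors `sgn (g ⬝ᵥ v)` cancel, and `b` survives only in the character `sgn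
  -- (b ⬝ᵥ v)`. Summed against `sgn (b ⬝ᵥ u)`, it forces `u = v`.
  have e1 : ∀ b, ∑ e, sgn (e ⬝ᵥ v) • sgn ((v + f) ⬝ᵥ (b + e)) • T (u + c + (v + f)) (b + e) =
      sgn (b ⬝ᵥ v) • ∑ g, sgn (g ⬝ᵥ f) • T (u + c + (v + f)) g := fun b => by
    rw [← Equiv.sum_comp (Equiv.addLeft b) fun g => sgn (g ⬝ᵥ f) • T (u + c + (v + f)) g,
      Finset.smul_sum]
    refine Finset.sum_congr rfl fun e _ => ?_
    simp only [Equiv.coe_addLeft, smul_smul]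
    congr 1
    rw [dotProduct_comm (v + f), dotProduct_add, sgn_add, ← mul_assoc, mul_comm (sgn (e ⬝ᵥ v)),
      add_dotProduct b e v, sgn_add, mul_assoc (sgn (b ⬝ᵥ v)), sgn_mul_self, mul_one]
  simp only [synth, e1]
  simp only [smul_smul, ← sgn_add, ← dotProduct_add, ← Finset.sum_smul]
  have e2 : ∑ b, sgn (b ⬝ᵥ (u + v)) = if u = v then (2 : ℂ) ^ (2 * n) else 0 := by
    simp only [dotProduct_comm _ (u + v), sum_sgn, add_eq_zero_bits]
  rw [e2]
  split_ifs with h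
  · subst h
    have e3 : u + c + (u + f) = c + f := by
      rw [add_add_add_comm, add_self_bits, zero_add]
    rw [e3]
    congr 1
    have h2 : (2 : ℂ) ^ (6 * n) = 2 ^ (4 * n) * 2 ^ (2 * n) := by
      rw [← pow_add]; congr 1; ring
    rw [h2]
    field_simp
  · simp

end Fourier

/-! ### The projector onto the EPR pairs -/

section EPR

variable {n : ℕ} {H : Type*} [NormedAddCommGroup H] [InnerProductSpace ℂ H]

theorem eprState_apply (x y : Qubits n) : eprState n (x, y) = if x = y then (2 ^ n)⁻¹ else 0 := by
  have h2 : (((√2)⁻¹ : ℝ) : ℂ) ^ 2 = 2⁻¹ := by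
    rw [← Complex.ofReal_pow, inv_pow, Real.sq_sqrt (by norm_num)]
    simp
  split_ifs with h
  · subst h
    simp only [eprState, epr, if_true, Fin.prod_const, pow_mul, h2, inv_pow]
  · obtain ⟨i, hi⟩ := Function.ne_iff.1 h
    exact Finset.prod_eq_zero (Finset.mem_univ i) (by simp [epr, hi])

theorem star_eprState : star (eprState n) = eprState n := by
  funext z
  rw [Pi.star_apply, eprState_apply]
  split_ifs <;> simp

theorem eprProj_apply (z w : Qubits n × Qubits n) :
    eprProj n z w = eprState n z * eprState n w := by
  rw [eprProj, star_eprState, Matrix.vecMulVec_apply]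

theorem eprProj_isHermitian : (eprProj n).conjTranspose = eprProj n := by
  ext z w
  have := congrFun (star_eprState (n := n))
  simp only [Pi.star_apply] at this
  rw [Matrix.conjTranspose_apply, eprProj_apply, eprProj_apply, star_mul, this, this]

theorem eprState_norm : eprState n ⬝ᵥ eprState n = 1 := by
  simp only [dotProduct, Fintype.sum_prod_type, eprState_apply]
  simp only [mul_ite, mul_zero, ite_mul, zero_mul]
  have : (2 : ℂ) ^ (2 * n) = 2 ^ n * 2 ^ n := by rw [← pow_add]; congr 1; ring
  simp [this]
  field_simp

theorem eprProj_mul_self : eprProj n * eprProj n = eprProj n := by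
  rw [eprProj, star_eprState, Matrix.vecMulVec_mul_vecMulVec, eprState_norm, one_smul]

theorem actOnOutput_apply (M : Matrix (Qubits n × Qubits n) (Qubits n × Qubits n) ℂ)
    (φ : Output n H) (u c v f : Qubits n) :
    actOnOutput M φ (u, c, v, f) = ∑ w, M (u, v) w • φ (w.1, c, w.2, f) := rfl

theorem actOnOutput_mul (M N : Matrix (Qubits n × Qubits n) (Qubits n × Qubits n) ℂ)
    (φ : Output n H) : actOnOutput (M * N) φ = actOnOutput M (actOnOutput N φ) := by
  refine PiLp.ext fun ⟨u, c, v, f⟩ => ?_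
  simp only [actOnOutput_apply, Matrix.mul_apply, Finset.sum_smul, Finset.smul_sum, smul_smul]
  exact Finset.sum_comm

theorem actOnOutput_sub (M : Matrix (Qubits n × Qubits n) (Qubits n × Qubits n) ℂ)
    (φ χ : Output n H) : actOnOutput M (φ - χ) = actOnOutput M φ - actOnOutput M χ := by
  refine PiLp.ext fun ⟨u, c, v, f⟩ => ?_
  simp only [actOnOutput_apply, PiLp.sub_apply, smul_sub, Finset.sum_sub_distrib]

theorem inner_actOnOutput (M : Matrix (Qubits n × Qubits n) (Qubits n × Qubits n) ℂ)
    (φ χ : Output n H) :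
    inner ℂ φ (actOnOutput M χ) = inner ℂ (actOnOutput M.conjTranspose φ) χ := by
  have reorder : ∀ g : Qubits n × Qubits n × Qubits n × Qubits n → ℂ,
      ∑ z, g z = ∑ c, ∑ f, ∑ w : Qubits n × Qubits n, g (w.1, c, w.2, f) := fun g => by
    simp only [Fintype.sum_prod_type]
    rw [Finset.sum_comm]
    refine Finset.sum_congr rfl fun c _ => ?_
    rw [Finset.sum_comm (s := Finset.univ (α := Qubits n)) (t := Finset.univ)
      (f := fun f x => ∑ y, g (x, c, y, f))]
    exact Finset.sum_congr rfl fun u _ => Finset.sum_comm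
  rw [PiLp.inner_apply, PiLp.inner_apply, reorder, reorder]
  simp only [actOnOutput_apply, sum_inner, inner_sum, inner_smul_left,
    inner_smul_right, Matrix.conjTranspose_apply]
  refine Finset.sum_congr rfl fun c _ => Finset.sum_congr rfl fun f _ => ?_
  rw [Finset.sum_comm]
  simp

/-- If `χ` is invariant under an orthogonal projection `M`, then the expectation of `M` in `φ`
misses `‖φ‖²` by at most `‖φ - χ‖²`. -/
theorem le_inner_actOnOutput {M : Matrix (Qubits n × Qubits n) (Qubits n × Qubits n) ℂ}
    (hM : M.conjTranspose = M) (hMM : M * M = M) (φ χ : Output n H) (hχ : actOnOutput M χ = χ) :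
    0 ≤ (inner ℂ φ (actOnOutput M φ)).re ∧
      ‖φ‖ ^ 2 - ‖φ - χ‖ ^ 2 ≤ (inner ℂ φ (actOnOutput M φ)).re := by
  have hq : ∀ y : Output n H, (inner ℂ y (actOnOutput M y)).re = ‖actOnOutput M y‖ ^ 2 := fun y => by
    conv_lhs => rw [← hMM, actOnOutput_mul, inner_actOnOutput, hM]
    rw [inner_self_eq_norm_sq_to_K]
    norm_cast
  have hd : ∀ y : Output n H, ‖y - actOnOutput M y‖ ^ 2 = ‖y‖ ^ 2 - ‖actOnOutput M y‖ ^ 2 := fun y => by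
    rw [@norm_sub_sq ℂ, RCLike.re_eq_complex_re, hq]
    ring
  refine ⟨by rw [hq]; positivity, ?_⟩
  -- The complementary projection kills `χ`, so the part of `φ` lost under `M` is a component of `φ
  -- - χ`.
  have h1 : φ - actOnOutput M φ = (φ - χ) - actOnOutput M (φ - χ) := by
    rw [actOnOutput_sub, hχ]; abel
  have h2 := hd φ
  rw [h1, hd] at h2
  rw [hq]
  nlinarith [sq_nonneg ‖actOnOutput M (φ - χ)‖]

/-- On equal pairs the projector averages over the `2 ^ (2 * n)` equal pairs, and a vector constant
there equals its average. Off the diagonal both sides vanish. -/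
theorem actOnOutput_eprProj_of_supported (J : Qubits n → Qubits n → Dilated n H)
    {χ : Output n H} (hχ : ∀ u c v f, χ (u, c, v, f) = if u = v then J c f else 0) :
    actOnOutput (eprProj n) χ = χ := by
  refine PiLp.ext fun ⟨u, c, v, f⟩ => ?_
  simp only [actOnOutput_apply, eprProj_apply, hχ, Fintype.sum_prod_type, eprState_apply,
    smul_ite, smul_zero, Finset.sum_ite_eq, Finset.mem_univ, if_true, Finset.sum_const,
    Finset.card_univ, Fintype.card_pi, ZMod.card, Finset.prod_const, Fintype.card_fin]
  split_ifs with h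
  · rw [← Nat.cast_smul_eq_nsmul ℂ, smul_smul]
    have : (2 : ℂ) ^ (2 * n) = 2 ^ n * 2 ^ n := by rw [← pow_add]; congr 1; ring
    push_cast
    rw [this]
    field_simp
    simp
  · simp

end EPR

/-! ### Projective measurements and their observables -/

section Obs

variable {H : Type*} [NormedAddCommGroup H] [InnerProductSpace ℂ H]
  {ι κ : Type*} [Fintype ι] [Fintype κ]

/-- The operator with value `f a` on outcome `a`. -/
def obs (P : ι → H →L[ℂ] H) (f : ι → ℂ) : H →L[ℂ] H := ∑ a, f a • P a

theorem obs_neg (P : ι → H →L[ℂ] H) (f : ι → ℂ) : obs P (-f) = -obs P f := by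
  simp [obs]

theorem commute_obs {P : ι → H →L[ℂ] H} {Q : κ → H →L[ℂ] H} (h : ∀ a b, Commute (P a) (Q b))
    (f : ι → ℂ) (g : κ → ℂ) : Commute (obs P f) (obs Q g) :=
  Commute.sum_left _ _ _ fun a _ => Commute.sum_right _ _ _ fun b _ =>
    ((h a b).smul_left _).smul_right _

end Obs

section Measurement

variable {H : Type*} [NormedAddCommGroup H] [InnerProductSpace ℂ H] [CompleteSpace H]
  {ι : Type*} [Fintype ι]

/-- A complete projective measurement. -/
structure IsPVM (P : ι → H →L[ℂ] H) : Prop where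
  proj : ∀ a, IsStarProjection (P a)
  orth : ∀ a a', a ≠ a' → P a * P a' = 0
  sum : ∑ a, P a = 1

namespace IsPVM

variable {P : ι → H →L[ℂ] H}

theorem norm_sq_eq_sum (hP : IsPVM P) (x : H) : ‖x‖ ^ 2 = ∑ a, ‖P a x‖ ^ 2 := by
  have h : ∀ x : H, ((‖x‖ ^ 2 : ℝ) : ℂ) = inner ℂ x x := fun x => by
    rw [inner_self_eq_norm_sq_to_K]; simp
  have hx : ∑ a, P a x = x := by
    rw [← sum_apply, hP.sum]; rfl
  have key : inner ℂ x x = ∑ a, inner ℂ (P a x) (P a x) := by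
    conv_lhs => rw [← hx, sum_inner]
    refine Finset.sum_congr rfl fun a _ => ?_
    have h1 : P a (P a x) = P a x :=
      congrArg (fun U : H →L[ℂ] H => U x) (hP.proj a).isIdempotentElem.eq
    have h2 := ContinuousLinearMap.isSelfAdjoint_iff_isSymmetric.1 (hP.proj a).isSelfAdjoint
      (P a x) x
    simp only [ContinuousLinearMap.coe_coe, h1] at h2
    rw [hx]
    exact h2
  apply Complex.ofReal_injective
  push_cast
  simpa only [← h, Complex.ofReal_pow] using key

theorem mul_obs [DecidableEq ι] (hP : IsPVM P) (a : ι) (f : ι → ℂ) :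
    P a * obs P f = f a • P a := by
  rw [obs, Finset.mul_sum, Finset.sum_eq_single a]
  · rw [mul_smul_comm, (hP.proj a).isIdempotentElem.eq]
  · intro b _ hb
    rw [mul_smul_comm, hP.orth a b hb.symm, smul_zero]
  · simp

theorem obs_mul [DecidableEq ι] (hP : IsPVM P) (f g : ι → ℂ) :
    obs P f * obs P g = obs P (f * g) := by
  conv_lhs => rw [obs, Finset.sum_mul]
  refine Finset.sum_congr rfl fun a _ => ?_
  rw [smul_mul_assoc, hP.mul_obs, smul_smul, Pi.mul_apply]

theorem obs_one (hP : IsPVM P) : obs P 1 = 1 := by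
  simp [obs, hP.sum]

theorem isometry_obs (hP : IsPVM P) {f : ι → ℂ} (hf : ∀ a, ‖f a‖ = 1) : Isometry (obs P f) := by
  classical
  refine AddMonoidHomClass.isometry_of_norm _ fun x => ?_
  rw [← sq_eq_sq₀ (norm_nonneg _) (norm_nonneg _), hP.norm_sq_eq_sum, hP.norm_sq_eq_sum x]
  refine Finset.sum_congr rfl fun a _ => ?_
  rw [← mul_apply_eq_comp, hP.mul_obs, smul_apply, norm_smul, hf, one_mul]

end IsPVM

end Measurement

/-! ### Controlled operators -/

section Controlled

variable {ι : Type*} {E : Type*} [NormedAddCommGroup E] [InnerProductSpace ℂ E]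

theorem controlled_apply (T : ι → E →L[ℂ] E) (x : Ext ι E) (i : ι) :
    controlled T x i = T i (x i) := rfl

theorem controlled_mul (T T' : ι → E →L[ℂ] E) :
    controlled T * controlled T' = controlled fun i => T i * T' i := rfl

theorem controlled_neg [Fintype ι] (T : ι → E →L[ℂ] E) : (controlled fun i => -T i) = -controlled T := by
  ext x i
  simp [controlled_apply]

theorem controlled_one : (controlled fun _ => 1 : Ext ι E →L[ℂ] Ext ι E) = 1 := rfl

theorem commute_controlled {T T' : ι → E →L[ℂ] E} (h : ∀ i, Commute (T i) (T' i)) :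
    Commute (controlled T) (controlled T') := by
  change _ * _ = _ * _
  rw [controlled_mul, controlled_mul]
  exact congrArg controlled (funext fun i => (h i).eq)

theorem isometry_controlled [Fintype ι] {T : ι → E →L[ℂ] E} (h : ∀ i, Isometry (T i)) :
    Isometry (controlled T) := by
  refine AddMonoidHomClass.isometry_of_norm _ fun x => ?_
  rw [← sq_eq_sq₀ (norm_nonneg _) (norm_nonneg _), PiLp.norm_sq_eq_of_L2, PiLp.norm_sq_eq_of_L2]
  refine Finset.sum_congr rfl fun i _ => ?_
  rw [controlled_apply, (AddMonoidHomClass.isometry_iff_norm _).1 (h i)]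

end Controlled

/-! ### Averages over questions -/

section Questions

variable {n : ℕ}

theorem glue_self (k : Fin n) (q : Fin 3) (ρ : {j : Fin n // j ≠ k} → Fin 3) :
    glue k q ρ k = q := by simp [glue]

theorem glue_injective (k : Fin n) (q : Fin 3) : Function.Injective (glue k q) := by
  intro ρ ρ' h
  funext j
  have := congrFun h j.1
  simpa [glue, j.2] using this

/-- The update is injective on each of the three fibres of `q k`. -/
theorem sum_update_le (f : Question n → ℝ) (hf : ∀ q, 0 ≤ f q) (k : Fin n) (x : Fin 3) :
    ∑ q, f (Function.update q k x) ≤ 3 * ∑ q, f q := by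
  rw [← Finset.sum_fiberwise (s := Finset.univ) (g := fun q : Question n => q k)]
  have : ∀ y : Fin 3, ∑ q : Question n with q k = y, f (Function.update q k x) ≤ ∑ q, f q := by
    intro y
    rw [← Finset.sum_image (f := f) (g := fun q : Question n => Function.update q k x)]
    · exact Finset.sum_le_univ_sum_of_nonneg hf
    · intro q hq q' hq' h
      simp only [Finset.coe_filter, Finset.mem_univ, true_and, Set.mem_ofPred_eq] at hq hq'
      funext j
      by_cases hj : j = k
      · rw [hj, hq, hq']
      · simpa [hj] using congrFun h j
  refine (Finset.sum_le_sum fun y _ => this y).trans (le_of_eq ?_)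
  simp

/-- Only the `k`-th register matters, and it runs through the third of the questions having `x` in
round `k`. Hence the mean over ancilla labels is at most three times the mean over all questions. -/
theorem sum_glue_le (f : Question n → ℝ) (hf : ∀ q, 0 ≤ f q) (k : Fin n) (x : Fin 3) :
    3 ^ n * ∑ α : Anc n, f (glue k x (α k)) ≤ 3 * Fintype.card (Anc n) * ∑ q, f q := by
  have hsplit : ∑ α : Anc n, f (glue k x (α k)) =
      Fintype.card ((j : {j : Fin n // j ≠ k}) → ({i : Fin n // i ≠ j.1} → Fin 3)) *
        ∑ ρ, f (glue k x ρ) := by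
    rw [← (Equiv.piSplitAt k fun k : Fin n => ({j : Fin n // j ≠ k} → Fin 3)).symm.sum_comp,
      Fintype.sum_prod_type, Finset.mul_sum]
    refine Finset.sum_congr rfl fun ρ _ => ?_
    simp [Equiv.piSplitAt]
  have hcard : Fintype.card (Anc n) = Fintype.card ({j : Fin n // j ≠ k} → Fin 3) *
      Fintype.card ((j : {j : Fin n // j ≠ k}) → ({i : Fin n // i ≠ j.1} → Fin 3)) := by
    rw [Fintype.card_congr (Equiv.piSplitAt k fun k : Fin n => ({j : Fin n // j ≠ k} → Fin 3)),
      Fintype.card_prod]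
  have hcard' : 3 ^ n = 3 * Fintype.card ({j : Fin n // j ≠ k} → Fin 3) := by
    have := Fintype.card_congr (Equiv.funSplitAt k (Fin 3))
    simpa only [Fintype.card_prod, Fintype.card_fun, Fintype.card_fin] using this
  have hle : ∑ ρ, f (glue k x ρ) ≤ ∑ q, f q := by
    rw [← Finset.sum_image (f := f) (g := glue k x) (glue_injective k x).injOn]
    exact Finset.sum_le_univ_sum_of_nonneg hf
  have hcard'' : (3 : ℝ) ^ n = 3 * Fintype.card ({j : Fin n // j ≠ k} → Fin 3) := by
    exact_mod_cast hcard'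
  rw [hsplit, hcard, hcard'']
  push_cast
  have := mul_le_mul_of_nonneg_left hle (a := 3 *
    (Fintype.card ({j : Fin n // j ≠ k} → Fin 3) : ℝ) *
    (Fintype.card ((j : {j : Fin n // j ≠ k}) → ({i : Fin n // i ≠ j.1} → Fin 3)) : ℝ))
    (by positivity)
  linarith

end Questions

/-! ### Relations among the observables of a good strategy -/

namespace Strategy

variable {n : ℕ} {H : Type*} [NormedAddCommGroup H] [InnerProductSpace ℂ H] [CompleteSpace H]
  (S : Strategy n H)

theorem pvmP (r : Question n) : IsPVM (S.P r) := ⟨S.P_proj r, S.P_orth r, S.P_sum r⟩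

theorem pvmQ (c : Question n) : IsPVM (S.Q c) := ⟨S.Q_proj c, S.Q_orth c, S.Q_sum c⟩

theorem aliceObs_eq (r : Question n) (c : Fin 3) (k : Fin n) :
    S.aliceObs r c k = obs (S.P r) fun a => sgn (aliceBit a c k) := rfl

theorem bobObs_eq (c : Question n) (r : Fin 3) (k : Fin n) :
    S.bobObs c r k = obs (S.Q c) fun b => sgn (bobBit b r k) := rfl

theorem isometry_aliceObs (r : Question n) (c : Fin 3) (k : Fin n) :
    Isometry (S.aliceObs r c k) := (S.pvmP r).isometry_obs fun _ => norm_sgn _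

theorem isometry_bobObs (c : Question n) (r : Fin 3) (k : Fin n) :
    Isometry (S.bobObs c r k) := (S.pvmQ c).isometry_obs fun _ => norm_sgn _

theorem commute_aliceObs_bobObs (r c : Question n) (c' r' : Fin 3) (k l : Fin n) :
    Commute (S.aliceObs r c' k) (S.bobObs c r' l) := commute_obs (S.comm r · c ·) _ _

theorem commute_aliceObs (r : Question n) (c c' : Fin 3) (k l : Fin n) :
    Commute (S.aliceObs r c k) (S.aliceObs r c' l) := by
  change _ * _ = _ * _
  simp only [aliceObs_eq, (S.pvmP r).obs_mul, mul_comm]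

theorem commute_bobObs (c : Question n) (r r' : Fin 3) (k l : Fin n) :
    Commute (S.bobObs c r k) (S.bobObs c r' l) := by
  change _ * _ = _ * _
  simp only [bobObs_eq, (S.pvmQ c).obs_mul, mul_comm]

theorem aliceObs_mul_self (r : Question n) (c : Fin 3) (k : Fin n) :
    S.aliceObs r c k * S.aliceObs r c k = 1 := by
  rw [aliceObs_eq, (S.pvmP r).obs_mul, ← (S.pvmP r).obs_one]
  exact congrArg _ (funext fun a => sgn_mul_self _)

theorem aliceObs_mul (r : Question n) {c c' c'' : Fin 3} (h : c ≠ c' ∧ c ≠ c'' ∧ c' ≠ c'')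
    (k : Fin n) : S.aliceObs r c k * S.aliceObs r c' k = S.aliceObs r c'' k := by
  rw [aliceObs_eq, aliceObs_eq, (S.pvmP r).obs_mul, aliceObs_eq]
  congr 1
  funext a
  rw [Pi.mul_apply, ← sgn_add]
  congr 1
  simp only [aliceBit]
  generalize a.1 k = x
  generalize a.2 k = y
  revert c c' c'' x y
  decide

theorem bobObs_mul (c : Question n) {r r' r'' : Fin 3} (h : r ≠ r' ∧ r ≠ r'' ∧ r' ≠ r'')
    (k : Fin n) : S.bobObs c r k * S.bobObs c r' k = -S.bobObs c r'' k := by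
  rw [bobObs_eq, bobObs_eq, (S.pvmQ c).obs_mul, bobObs_eq, ← obs_neg]
  congr 1
  funext b
  rw [Pi.mul_apply, Pi.neg_apply, ← sgn_add, neg_eq_neg_one_mul, ← sgn_one, ← sgn_add]
  congr 1
  simp only [bobBit]
  generalize b.1 k = x
  generalize b.2 k = y
  revert r r' r'' x y
  decide

/-- The squared distance on the state between the matching observables of the two players for
round `k`, when the questions are `r` and `c`. -/
def discrepancy (k : Fin n) (r c : Question n) : ℝ :=
  ‖S.aliceObs r (c k) k S.state - S.bobObs c (r k) k S.state‖ ^ 2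

theorem discrepancy_nonneg (k : Fin n) (r c : Question n) : 0 ≤ S.discrepancy k r c :=
  sq_nonneg _

theorem sum_prob (r c : Question n) : ∑ a, ∑ b, ‖S.P r a (S.Q c b S.state)‖ ^ 2 = 1 := by
  rw [Finset.sum_comm]
  simp only [← (S.pvmP r).norm_sq_eq_sum, ← (S.pvmQ c).norm_sq_eq_sum, S.norm_state, one_pow]

-- In the component of the difference vector at outcomes `a`, `b`, the amplitude is multiplied by a
-- difference of two signs. It vanishes when round `k` is won, in particular when all rounds are,
-- and otherwise its square is at most 4.
open Classical in
theorem discrepancy_le (k : Fin n) (r c : Question n) :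
    S.discrepancy k r c ≤ 4 * (1 - ∑ a, ∑ b,
      if Wins r c a b then ‖S.P r a (S.Q c b S.state)‖ ^ 2 else 0) := by
  have happ : ∀ a b, S.P r a (S.Q c b
      (S.aliceObs r (c k) k S.state - S.bobObs c (r k) k S.state)) =
      (sgn (aliceBit a (c k) k) - sgn (bobBit b (r k) k)) • S.P r a (S.Q c b S.state) := by
    intro a b
    have h1 : S.P r a * (S.Q c b * S.aliceObs r (c k) k) =
        sgn (aliceBit a (c k) k) • (S.P r a * S.Q c b) := by
      have : Commute (S.Q c b) (S.aliceObs r (c k) k) :=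
        Commute.sum_right _ _ _ fun a _ => ((S.comm r a c b).symm).smul_right _
      rw [this.eq, ← mul_assoc, aliceObs_eq, (S.pvmP r).mul_obs, smul_mul_assoc]
    have h2 : S.P r a * (S.Q c b * S.bobObs c (r k) k) =
        sgn (bobBit b (r k) k) • (S.P r a * S.Q c b) := by
      rw [bobObs_eq, (S.pvmQ c).mul_obs, mul_smul_comm]
    have h1' := congrArg (fun U : H →L[ℂ] H => U S.state) h1
    have h2' := congrArg (fun U : H →L[ℂ] H => U S.state) h2
    simp only [mul_apply_eq_comp, smul_apply] at h1' h2'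
    rw [map_sub, map_sub, h1', h2', sub_smul]
  rw [← S.sum_prob r c, ← Finset.sum_sub_distrib, Finset.mul_sum, discrepancy,
    (S.pvmQ c).norm_sq_eq_sum]
  simp only [(S.pvmP r).norm_sq_eq_sum (S.Q c _ _), happ]
  rw [Finset.sum_comm]
  refine Finset.sum_le_sum fun a _ => ?_
  rw [← Finset.sum_sub_distrib, Finset.mul_sum]
  refine Finset.sum_le_sum fun b _ => ?_
  rw [norm_smul, mul_pow]
  split_ifs with h
  · rw [h k, sub_self]
    simp
  · rw [sub_zero]
    have h2 : ‖sgn (aliceBit a (c k) k) - sgn (bobBit b (r k) k)‖ ≤ 2 :=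
      (norm_sub_le _ _).trans (by rw [norm_sgn, norm_sgn]; norm_num)
    refine mul_le_mul_of_nonneg_right ?_ (sq_nonneg _)
    nlinarith [norm_nonneg (sgn (aliceBit a (c k) k) - sgn (bobBit b (r k) k))]

theorem sum_discrepancy_le {ε : ℝ} (hS : 1 - ε ≤ S.winProb) (k : Fin n) :
    ∑ r, ∑ c, S.discrepancy k r c ≤ 4 * ε * (3 ^ n * 3 ^ n) := by
  classical
  refine (Finset.sum_le_sum fun r _ => Finset.sum_le_sum fun c _ =>
    S.discrepancy_le k r c).trans ?_
  simp only [← Finset.mul_sum, Finset.sum_sub_distrib]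
  rw [winProb, le_div_iff₀ (by positivity)] at hS
  simp only [Finset.sum_const, Finset.card_univ, Fintype.card_fun, Fintype.card_fin, nsmul_eq_mul]
  push_cast
  linarith

end Strategy
-- Commutation and anticommutation from agreement between the players
section Relations

variable {E : Type*} [NormedAddCommGroup E] [NormedSpace ℂ E] {ψ : E} {δ : ℝ}

/-- Operators which are close on `ψ` to commuting operators of the other player approximately
commute on `ψ`. -/
theorem dist_commutator_le {S₁ S₂ T₁ T₂ : E →L[ℂ] E} (hS₁ : Isometry S₁) (hS₂ : Isometry S₂)
    (hT₁ : Isometry T₁) (hT₂ : Isometry T₂) (h12 : Commute S₁ T₂) (h21 : Commute S₂ T₁)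
    (hT : Commute T₁ T₂) (h₁ : dist (S₁ ψ) (T₁ ψ) ≤ δ) (h₂ : dist (S₂ ψ) (T₂ ψ) ≤ δ) :
    dist (S₁ (S₂ ψ)) (S₂ (S₁ ψ)) ≤ 4 * δ := by
  have half : ∀ {S T S' T' : E →L[ℂ] E}, Isometry S → Isometry T' → Commute S T' →
      dist (S ψ) (T ψ) ≤ δ → dist (S' ψ) (T' ψ) ≤ δ →
      dist (S (S' ψ)) (T' (T ψ)) ≤ 2 * δ := by
    intro S T S' T' hS hT' hc h h'
    refine (dist_triangle _ (S (T' ψ)) _).trans ?_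
    rw [hS.dist_eq, commute_apply hc, hT'.dist_eq]
    linarith
  have a := half hS₁ hT₂ h12 h₁ h₂
  have b := half hS₂ hT₁ h21 h₂ h₁
  rw [commute_apply hT] at b
  refine (dist_triangle_right _ _ (T₂ (T₁ ψ))).trans ?_
  linarith

/-- The anticommutation relation in the Magic Square: operators in a square whose rows multiply
to `1` exactly and whose columns multiply to `-1` for the other player. -/
theorem dist_anticommutator_le {A B : Fin 3 × Fin 3 → E →L[ℂ] E} (h : Matched A B ψ δ)
    (hA : ∀ r c c' c'', c ≠ c' ∧ c ≠ c'' ∧ c' ≠ c'' → A (r, c) * A (r, c') = A (r, c''))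
    (hB : ∀ c r r' r'', r ≠ r' ∧ r ≠ r'' ∧ r' ≠ r'' → B (r, c) * B (r', c) = -B (r'', c))
    {c c' : Fin 3} (hc : c ≠ c') :
    dist (A (0, c) (A (1, c') ψ)) (-(A (1, c') (A (0, c) ψ))) ≤ 11 * δ := by
  have hA' : ∀ r c c' c'' x, c ≠ c' ∧ c ≠ c'' ∧ c' ≠ c'' →
      A (r, c) (A (r, c') x) = A (r, c'') x := fun r c c' c'' x hne =>
    congrArg (fun U : E →L[ℂ] E => U x) (hA r c c' c'' hne)
  -- A column product of Alice's is turned into Bob's, where it is exact, and the result is turned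
  -- back: three exchanges.
  have col : ∀ c r r' r'', r ≠ r' ∧ r ≠ r'' ∧ r' ≠ r'' →
      dist (A (r, c) (A (r', c) ψ)) (-(A (r'', c) ψ)) ≤ 3 * δ := by
    intro c r r' r'' hne
    have e : B (r', c) (B (r, c) ψ) = -(B (r'', c) ψ) :=
      congrArg (fun U : E →L[ℂ] E => U ψ) (hB c r' r r'' ⟨hne.1.symm, hne.2.2, hne.2.1⟩)
    refine (dist_triangle4 _ (A (r, c) (B (r', c) ψ)) (B (r', c) (B (r, c) ψ)) _).trans ?_
    rw [(h.isoA _).dist_eq, commute_apply (h.comm _ _), (h.isoB _).dist_eq, e, dist_neg_neg,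
      dist_comm (B (r'', c) ψ)]
    linarith [h.close (r', c), h.close (r, c), h.close (r'', c)]
  obtain ⟨d, hcd, hcd'⟩ : ∃ d, c ≠ d ∧ c' ≠ d := by revert c c'; decide
  -- With `d` the third column, each step splits one factor by an exact row relation and then
  -- contracts a column: `c'`, then `d`, then `c`, with one sign each time. The middle contraction
  -- takes place behind the letter `A (2, c)`, which costs `2 * δ` more.
  have s1 : dist (A (0, c) (A (1, c') ψ)) (-(A (0, d) (A (2, c') ψ))) ≤ 3 * δ := by
    rw [← hA' 0 d c' c _ ⟨hcd'.symm, hcd.symm, hc.symm⟩, ← map_neg, (h.isoA _).dist_eq]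
    exact col c' 0 1 2 (by decide)
  have s2 : dist (-(A (0, d) (A (2, c') ψ))) (A (1, d) (A (2, c) ψ)) ≤ 5 * δ := by
    have := h.suffix (isometry_mul_clm (h.isoA (0, d)) (h.isoA (2, d))) (h.isoA (1, d))
      (fun l => (h.comm _ l).mul_left (h.comm _ l)) (h.comm _) (s := -1) (by simp) (c := 3 * δ)
      (by simpa using col d 0 2 1 (by decide)) [(2, c)]
    rw [← hA' 2 d c c' _ ⟨hcd.symm, hcd'.symm, hc⟩, ← dist_neg_neg, neg_neg]
    simp only [List.map_cons, List.map_nil, List.prod_cons, List.prod_nil, mul_one,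
      mul_apply_eq_comp, neg_smul, one_smul, List.length_singleton, Nat.cast_one, one_mul] at this
    linarith
  have s3 : dist (A (1, d) (A (2, c) ψ)) (-(A (1, c') (A (0, c) ψ))) ≤ 3 * δ := by
    rw [← hA' 1 d c c' _ ⟨hcd.symm, hcd'.symm, hc⟩, ← map_neg, (h.isoA _).dist_eq, dist_comm,
      ← dist_neg_neg, neg_neg]
    exact col c 1 0 2 (by decide)
  exact ((dist_triangle4 _ _ _ _).trans (add_le_add_three s1 s2 s3)).trans (by linarith)

end Relations

/-! ### The dilated observables on the dilated state -/

namespace Strategy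

variable {n : ℕ} {H : Type*} [NormedAddCommGroup H] [InnerProductSpace ℂ H] [CompleteSpace H]
  (S : Strategy n H)

theorem norm_dilatedState : ‖S.dilatedState‖ = 1 := by
  rw [← sq_eq_sq₀ (norm_nonneg _) zero_le_one, PiLp.norm_sq_eq_of_L2]
  simp only [dilatedState, norm_smul, S.norm_state, norm_inv, Complex.norm_natCast, mul_one,
    Finset.sum_const, Finset.card_univ, Fintype.card_prod, nsmul_eq_mul]
  have : (Fintype.card (Anc n) : ℝ) ≠ 0 := Nat.cast_ne_zero.2 Fintype.card_ne_zero
  push_cast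
  field_simp

/-- Bob's observable in round `k` for a fixed question vector, acting trivially on the
ancillas. -/
def bobFixed (c : Question n) (r : Fin 3) (k : Fin n) : Dilated n H →L[ℂ] Dilated n H :=
  controlled fun _ => S.bobObs c r k

theorem isometry_aliceDilated (r c : Fin 3) (k : Fin n) : Isometry (S.aliceDilated r c k) :=
  isometry_controlled fun _ => S.isometry_aliceObs _ _ _

theorem isometry_bobDilated (r c : Fin 3) (k : Fin n) : Isometry (S.bobDilated r c k) :=
  isometry_controlled fun _ => S.isometry_bobObs _ _ _

theorem isometry_bobFixed (c : Question n) (r : Fin 3) (k : Fin n) :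
    Isometry (S.bobFixed c r k) :=
  isometry_controlled fun _ => S.isometry_bobObs _ _ _

theorem commute_aliceDilated_bobDilated (r c r' c' : Fin 3) (k l : Fin n) :
    Commute (S.aliceDilated r c k) (S.bobDilated r' c' l) :=
  commute_controlled fun _ => S.commute_aliceObs_bobObs _ _ _ _ _ _

theorem commute_aliceDilated_bobFixed (r c r' : Fin 3) (c' : Question n) (k l : Fin n) :
    Commute (S.aliceDilated r c k) (S.bobFixed c' r' l) :=
  commute_controlled fun _ => S.commute_aliceObs_bobObs _ _ _ _ _ _

theorem commute_bobFixed (c : Question n) (r r' : Fin 3) (k l : Fin n) :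
    Commute (S.bobFixed c r k) (S.bobFixed c r' l) :=
  commute_controlled fun _ => S.commute_bobObs _ _ _ _ _

theorem commute_aliceDilated (r c c' : Fin 3) (k : Fin n) :
    Commute (S.aliceDilated r c k) (S.aliceDilated r c' k) :=
  commute_controlled fun _ => S.commute_aliceObs _ _ _ _ _

theorem aliceDilated_mul_self (r c : Fin 3) (k : Fin n) :
    S.aliceDilated r c k * S.aliceDilated r c k = 1 := by
  rw [aliceDilated, controlled_mul, ← controlled_one]
  exact congrArg controlled (funext fun _ => S.aliceObs_mul_self _ _ _)

theorem aliceDilated_mul (r : Fin 3) {c c' c'' : Fin 3} (h : c ≠ c' ∧ c ≠ c'' ∧ c' ≠ c'')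
    (k : Fin n) : S.aliceDilated r c k * S.aliceDilated r c' k = S.aliceDilated r c'' k := by
  rw [aliceDilated, aliceDilated, controlled_mul]
  exact congrArg controlled (funext fun _ => S.aliceObs_mul _ h _)

theorem bobDilated_mul (c : Fin 3) {r r' r'' : Fin 3} (h : r ≠ r' ∧ r ≠ r'' ∧ r' ≠ r'')
    (k : Fin n) : S.bobDilated r c k * S.bobDilated r' c k = -S.bobDilated r'' c k := by
  rw [bobDilated, bobDilated, controlled_mul, bobDilated, ← controlled_neg]
  exact congrArg controlled (funext fun _ => S.bobObs_mul _ h _)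

/-- All ancilla branches carry the same multiple of the state, so the squared distance is a mean
over branches. -/
theorem dist_controlled_dilatedState_sq (T T' : Anc n × Anc n → H →L[ℂ] H) :
    (Fintype.card (Anc n) : ℝ) ^ 2 *
      dist (controlled T S.dilatedState) (controlled T' S.dilatedState) ^ 2 =
      ∑ α, ‖T α S.state - T' α S.state‖ ^ 2 := by
  rw [dist_eq_norm, PiLp.norm_sq_eq_of_L2, Finset.mul_sum]
  refine Finset.sum_congr rfl fun α _ => ?_
  have hN : (Fintype.card (Anc n) : ℝ) ≠ 0 := Nat.cast_ne_zero.2 Fintype.card_ne_zero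
  rw [PiLp.sub_apply, controlled_apply, controlled_apply]
  simp only [dilatedState, map_smul, ← smul_sub, norm_smul, norm_inv, Complex.norm_natCast]
  field_simp

variable {S} {ε : ℝ}

/-- The mean discrepancy is at most `4 * ε`; fixing the round-`k` question of each player costs a
factor 3 per player, giving `36 * ε`. -/
theorem dist_aliceDilated_bobDilated (hε : 0 ≤ ε) (hS : 1 - ε ≤ S.winProb) (r c : Fin 3)
    (k : Fin n) :
    dist (S.aliceDilated r c k S.dilatedState) (S.bobDilated r c k S.dilatedState) ≤ 6 * √ε := by
  have hN : (0 : ℝ) < Fintype.card (Anc n) := Nat.cast_pos.2 Fintype.card_pos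
  have h3 : (0 : ℝ) < 3 ^ n := by positivity
  have hD := S.discrepancy_nonneg k
  have key := S.dist_controlled_dilatedState_sq (fun α => S.aliceObs (glue k r (α.1 k)) c k)
    fun α => S.bobObs (glue k c (α.2 k)) r k
  have e : ∑ α : Anc n × Anc n, ‖S.aliceObs (glue k r (α.1 k)) c k S.state -
      S.bobObs (glue k c (α.2 k)) r k S.state‖ ^ 2 =
      ∑ α : Anc n, ∑ β : Anc n, S.discrepancy k (glue k r (α k)) (glue k c (β k)) := by
    simp only [Fintype.sum_prod_type, discrepancy, glue_self]
  rw [e] at key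
  have h1 := sum_glue_le (fun q => ∑ β : Anc n, S.discrepancy k q (glue k c (β k)))
    (fun q => Finset.sum_nonneg fun _ _ => hD _ _) k r
  have h2 : 3 ^ n * ∑ q, ∑ β : Anc n, S.discrepancy k q (glue k c (β k)) ≤
      3 * Fintype.card (Anc n) * ∑ q, ∑ q', S.discrepancy k q q' := by
    rw [Finset.mul_sum, Finset.mul_sum]
    exact Finset.sum_le_sum fun q _ => sum_glue_le (S.discrepancy k q) (hD q) k c
  have h4 := S.sum_discrepancy_le hS k
  have h5 : 3 ^ n * (3 ^ n * ((Fintype.card (Anc n) : ℝ) ^ 2 *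
      dist (S.aliceDilated r c k S.dilatedState) (S.bobDilated r c k S.dilatedState) ^ 2)) ≤
      3 ^ n * (3 ^ n * ((Fintype.card (Anc n) : ℝ) ^ 2 * (36 * ε))) := by
    rw [aliceDilated, bobDilated, key]
    calc _ ≤ (3 : ℝ) ^ n * (3 * Fintype.card (Anc n) *
          ∑ q, ∑ β : Anc n, S.discrepancy k q (glue k c (β k))) :=
          mul_le_mul_of_nonneg_left h1 h3.le
      _ = 3 * Fintype.card (Anc n) *
          (3 ^ n * ∑ q, ∑ β : Anc n, S.discrepancy k q (glue k c (β k))) := by ring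
      _ ≤ 3 * Fintype.card (Anc n) * (3 * Fintype.card (Anc n) *
          (4 * ε * (3 ^ n * 3 ^ n))) :=
          mul_le_mul_of_nonneg_left (h2.trans (mul_le_mul_of_nonneg_left h4 (by positivity)))
            (by positivity)
      _ = _ := by ring
  have h6 := le_of_mul_le_mul_left (le_of_mul_le_mul_left (le_of_mul_le_mul_left h5 h3) h3)
    (by positivity)
  refine (sq_le_sq₀ dist_nonneg (by positivity)).1 ?_
  rw [mul_pow, Real.sq_sqrt hε]
  linarith

/-- The two observables of Alice may come from different questions, hence need not commute exactly.
A good question for Bob, the same for both, is found by averaging. The condition `hkl` is what lets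
it contain `c` in round `k` and `c'` in round `l`. -/
theorem exists_bobFixed (hε : 0 ≤ ε) (hS : 1 - ε ≤ S.winProb) (r r' c c' : Fin 3) (k l : Fin n)
    (hkl : k = l → c = c') :
    ∃ q, dist (S.aliceDilated r c k S.dilatedState) (S.bobFixed q r k S.dilatedState) ≤ 15 * √ε ∧
      dist (S.aliceDilated r' c' l S.dilatedState) (S.bobFixed q r' l S.dilatedState) ≤
        15 * √ε := by
  have hN : (0 : ℝ) < Fintype.card (Anc n) := Nat.cast_pos.2 Fintype.card_pos
  have h3 : (0 : ℝ) < 3 ^ n := by positivity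
  let D : Fin 3 → Fin n → Question n → ℝ := fun r k q =>
    ∑ α : Anc n, S.discrepancy k (glue k r (α k)) q
  have hD : ∀ r k q, 0 ≤ D r k q := fun r k q =>
    Finset.sum_nonneg fun _ _ => S.discrepancy_nonneg _ _ _
  have hsum : ∀ r k, ∑ q, D r k q ≤ 3 ^ n * (12 * Fintype.card (Anc n) * ε) := by
    intro r k
    have h1 := sum_glue_le (fun p => ∑ q, S.discrepancy k p q)
      (fun q => Finset.sum_nonneg fun _ _ => S.discrepancy_nonneg _ _ _) k r
    have h4 := S.sum_discrepancy_le hS k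
    refine le_of_mul_le_mul_left (a := (3 : ℝ) ^ n) ?_ h3
    rw [Finset.sum_comm]
    exact h1.trans ((mul_le_mul_of_nonneg_left h4 (by positivity)).trans (le_of_eq (by ring)))
  have hF := (sum_update_le (fun q => D r k (Function.update q l c') +
      D r' l (Function.update q l c')) (fun q => add_nonneg (hD _ _ _) (hD _ _ _)) k c).trans
    (mul_le_mul_of_nonneg_left
      (sum_update_le (fun q => D r k q + D r' l q) (fun q => add_nonneg (hD _ _ _) (hD _ _ _)) l c')
      (by norm_num))
  rw [Finset.sum_add_distrib (f := D r k)] at hF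
  -- With `N` ancilla labels, each of the two terms has mean at most `12 * N * ε` over Bob's
  -- questions, and the two updates cost a factor 9: 9 · 24 = 216. Later, 216 ≤ 15².
  have hF' : ∑ q : Question n, (D r k (Function.update (Function.update q k c) l c') +
      D r' l (Function.update (Function.update q k c) l c')) ≤
      ∑ _q : Question n, 216 * Fintype.card (Anc n) * ε := by
    refine hF.trans ?_
    simp only [Finset.sum_const, Finset.card_univ, Fintype.card_fun, Fintype.card_fin,
      nsmul_eq_mul]
    push_cast
    nlinarith [hsum r k, hsum r' l]
  obtain ⟨q₀, -, hq₀⟩ := Finset.exists_le_of_sum_le Finset.univ_nonempty hF'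
  set q := Function.update (Function.update q₀ k c) l c' with hq
  have hql : q l = c' := by simp [hq]
  have hqk : q k = c := by
    by_cases h : k = l
    · rw [h, hql, hkl h]
    · simp [hq, h]
  have fin : ∀ r k, D r k q ≤ 216 * Fintype.card (Anc n) * ε →
      dist (S.aliceDilated r (q k) k S.dilatedState) (S.bobFixed q r k S.dilatedState) ≤
        15 * √ε := by
    intro r k h
    have key := S.dist_controlled_dilatedState_sq
      (fun α => S.aliceObs (glue k r (α.1 k)) (q k) k) fun α => S.bobObs q r k
    have e : ∑ α : Anc n × Anc n, ‖S.aliceObs (glue k r (α.1 k)) (q k) k S.state -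
        S.bobObs q r k S.state‖ ^ 2 = Fintype.card (Anc n) * D r k q := by
      simp only [Fintype.sum_prod_type, D, discrepancy, glue_self, Finset.sum_const,
        Finset.card_univ, nsmul_eq_mul, Finset.mul_sum]
    rw [e] at key
    have h5 : (Fintype.card (Anc n) : ℝ) ^ 2 *
        dist (S.aliceDilated r (q k) k S.dilatedState) (S.bobFixed q r k S.dilatedState) ^ 2 ≤
        (Fintype.card (Anc n) : ℝ) ^ 2 * (216 * ε) := by
      rw [aliceDilated, bobFixed, key]
      exact (mul_le_mul_of_nonneg_left h hN.le).trans (le_of_eq (by ring))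
    have h6 := le_of_mul_le_mul_left h5 (by positivity)
    refine (sq_le_sq₀ dist_nonneg (by positivity)).1 ?_
    rw [mul_pow, Real.sq_sqrt hε]
    linarith
  refine ⟨q, ?_, ?_⟩
  · rw [← hqk]
    exact fin r k (by linarith [hD r' l q])
  · rw [← hql]
    exact fin r' l (by linarith [hD r k q])

/-- The argument gives 4 · 15 = 60; the bound is weakened to 66 = 11 · 6 so that one `κ` also serves
for anticommutation. -/
theorem dist_commutator_aliceDilated (hε : 0 ≤ ε) (hS : 1 - ε ≤ S.winProb) (r r' c c' : Fin 3)
    (k l : Fin n) (hkl : k = l → c = c') :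
    dist (S.aliceDilated r c k (S.aliceDilated r' c' l S.dilatedState))
      (S.aliceDilated r' c' l (S.aliceDilated r c k S.dilatedState)) ≤ 66 * √ε := by
  obtain ⟨q, h1, h2⟩ := exists_bobFixed hε hS r r' c c' k l hkl
  refine (dist_commutator_le (S.isometry_aliceDilated _ _ _) (S.isometry_aliceDilated _ _ _)
    (S.isometry_bobFixed _ _ _) (S.isometry_bobFixed _ _ _)
    (S.commute_aliceDilated_bobFixed _ _ _ _ _ _) (S.commute_aliceDilated_bobFixed _ _ _ _ _ _)
    (S.commute_bobFixed _ _ _ _ _) h1 h2).trans ?_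
  linarith [Real.sqrt_nonneg ε]

theorem dist_anticommutator_aliceDilated (hε : 0 ≤ ε) (hS : 1 - ε ≤ S.winProb) {c c' : Fin 3}
    (hc : c ≠ c') (k : Fin n) :
    dist (S.aliceDilated 0 c k (S.aliceDilated 1 c' k S.dilatedState))
      (-(S.aliceDilated 1 c' k (S.aliceDilated 0 c k S.dilatedState))) ≤ 66 * √ε := by
  have h : Matched (fun p : Fin 3 × Fin 3 => S.aliceDilated p.1 p.2 k)
      (fun p => S.bobDilated p.1 p.2 k) S.dilatedState (6 * √ε) :=
    ⟨fun _ => S.isometry_aliceDilated _ _ _, fun _ => S.isometry_bobDilated _ _ _,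
      fun _ _ => S.commute_aliceDilated_bobDilated _ _ _ _ _ _,
      fun _ => dist_aliceDilated_bobDilated hε hS _ _ _⟩
  exact (dist_anticommutator_le h (fun r _ _ _ hne => S.aliceDilated_mul r hne k)
    (fun c _ _ _ hne => S.bobDilated_mul c hne k) hc).trans (by linarith)

/-! ### Approximate Paulis and the isometry -/

variable (S)

/-- Alice's operators `X i` (labelled by `(true, i)`) and `Z i` (labelled by `(false, i)`). -/
def pauliA (l : Bool × Fin (2 * n)) : Dilated n H →L[ℂ] Dilated n H :=
  if l.1 then S.XA l.2 else S.ZA l.2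

/-- Bob's operators `X i` (labelled by `(true, i)`) and `Z i` (labelled by `(false, i)`). -/
def pauliB (l : Bool × Fin (2 * n)) : Dilated n H →L[ℂ] Dilated n H :=
  if l.1 then S.XB l.2 else S.ZB l.2

/-- The row of the Magic Square used for `X` and for `Z`. -/
def pauliRow (t : Bool) : Fin 3 := if t then 1 else 0

/-- The column of the Magic Square used for `X` and for `Z` on qubit `i`. -/
def pauliCol (t : Bool) (i : Fin (2 * n)) : Fin 3 := if (i.val % 2 = 0 ↔ t) then 1 else 0

theorem pauliA_eq (t : Bool) (i : Fin (2 * n)) :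
    S.pauliA (t, i) = S.aliceDilated (pauliRow t) (pauliCol t i) (round i) := by
  cases t <;> by_cases h : i.val % 2 = 0 <;> simp [pauliA, XA, ZA, pauliRow, pauliCol, h]

theorem pauliB_eq (t : Bool) (i : Fin (2 * n)) :
    S.pauliB (t, i) = S.bobDilated (pauliRow t) (pauliCol t i) (round i) := by
  cases t <;> by_cases h : i.val % 2 = 0 <;> simp [pauliB, XB, ZB, pauliRow, pauliCol, h]

theorem isometry_pauliA (l : Bool × Fin (2 * n)) : Isometry (S.pauliA l) := by
  rw [show l = (l.1, l.2) from rfl, pauliA_eq]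
  exact S.isometry_aliceDilated _ _ _

theorem isometry_pauliB (l : Bool × Fin (2 * n)) : Isometry (S.pauliB l) := by
  rw [show l = (l.1, l.2) from rfl, pauliB_eq]
  exact S.isometry_bobDilated _ _ _

theorem WA_eq (a b : Qubits n) : S.WA a b =
    powWord (fun i => S.pauliA (true, i)) (List.finRange (2 * n)) a *
      powWord (fun i => S.pauliA (false, i)) (List.finRange (2 * n)) b := by
  simp only [WA, List.ofFn_eq_map, powWord, pauliA]
  rfl

theorem WB_eq (d e : Qubits n) : S.WB d e =
    powWord (fun i => S.pauliB (true, i)) (List.finRange (2 * n)).reverse d *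
      powWord (fun i => S.pauliB (false, i)) (List.finRange (2 * n)).reverse e := by
  simp only [WB, List.ofFn_eq_map, powWord, pauliB, List.map_reverse]
  rfl

theorem isometry_powWord {E ι : Type*} [NormedAddCommGroup E] [NormedSpace ℂ E]
    {G : ι → E →L[ℂ] E} (hG : ∀ i, Isometry (G i)) (L : List ι) (x : ι → ZMod 2) :
    Isometry (powWord G L x) :=
  isometry_list_prod fun T hT => by
    obtain ⟨i, -, rfl⟩ := List.mem_map.1 hT
    exact isometry_pow_clm (hG i) _

theorem isometry_WA_mul_WB (a b d e : Qubits n) : Isometry (S.WA a b * S.WB d e) := by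
  rw [WA_eq, WB_eq]
  exact isometry_mul_clm
    (isometry_mul_clm (isometry_powWord (fun _ => S.isometry_pauliA _) _ _)
      (isometry_powWord (fun _ => S.isometry_pauliA _) _ _))
    (isometry_mul_clm (isometry_powWord (fun _ => S.isometry_pauliB _) _ _)
      (isometry_powWord (fun _ => S.isometry_pauliB _) _ _))

theorem tensorKet_apply {ι E : Type*} [DecidableEq ι] [Fintype ι] [NormedAddCommGroup E]
    [InnerProductSpace ℂ E] (i j : ι) (x : E) :
    (tensorKet i x : Ext ι E) j = if i = j then x else 0 := by
  change (Pi.single i x : ι → E) j = _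
  simp only [Pi.single_apply, eq_comm]

theorem V_apply (x : Dilated n H) : S.V x = synth fun a b d e => S.WA a b (S.WB d e x) := by
  refine PiLp.ext fun ⟨u, c, v, f⟩ => ?_
  have key : ∀ (a c' d f' : Qubits n) (y : Dilated n H),
      (tensorKet (a + c', c', d + f', f') y : Output n H) (u, c, v, f) =
        if a = u + c then if c' = c then if d = v + f then if f' = f then y else 0 else 0 else 0
        else 0 := by
    intro a c' d f' y
    rw [tensorKet_apply]
    have h : (a + c', c', d + f', f') = (u, c, v, f) ↔
        a = u + c ∧ c' = c ∧ d = v + f ∧ f' = f := by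
      have hadd : ∀ x y z : Qubits n, x + y = z ↔ x = z + y := fun x y z => by
        constructor <;> rintro rfl <;> rw [add_assoc, add_self_bits, add_zero]
      simp only [Prod.mk.injEq, hadd]
      constructor
      · rintro ⟨h1, h2, h3, h4⟩
        exact ⟨h2 ▸ h1, h2, h4 ▸ h3, h4⟩
      · rintro ⟨h1, h2, h3, h4⟩
        exact ⟨h2 ▸ h1, h2, h4 ▸ h3, h4⟩
    simp only [h, ite_and]
  simp only [V, smul_apply, sum_apply, PiLp.smul_apply, WithLp.ofLp_sum, Finset.sum_apply, synth,
    ContinuousLinearMap.comp_apply, key, mul_apply_eq_comp]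
  congr 1
  rw [Finset.sum_eq_single (u + c) (fun a _ ha => by simp [ha]) (by simp)]
  refine Finset.sum_congr rfl fun b _ => ?_
  rw [Finset.sum_eq_single c (fun a _ ha => by simp [ha]) (by simp),
    Finset.sum_eq_single (v + f) (fun a _ ha => by simp [ha]) (by simp), Finset.smul_sum]
  refine Finset.sum_congr rfl fun e _ => ?_
  rw [Finset.sum_eq_single f (fun a _ ha => by simp [ha]) (by simp)]
  simp only [if_true, smul_smul, add_assoc, add_self_bits, add_zero]

theorem isometry_V : Isometry S.V := by
  refine AddMonoidHomClass.isometry_of_norm _ fun x => ?_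
  rw [← sq_eq_sq₀ (norm_nonneg _) (norm_nonneg _), V_apply]
  refine norm_synth_sq_of_const _ fun a b d e => ?_
  have := (AddMonoidHomClass.isometry_iff_norm _).1 (S.isometry_WA_mul_WB a b d e) x
  rw [mul_apply_eq_comp] at this
  rw [this]

variable {S}

theorem matched_pauli (hε : 0 ≤ ε) (hS : 1 - ε ≤ S.winProb) :
    Matched S.pauliA S.pauliB S.dilatedState (6 * √ε) where
  isoA := S.isometry_pauliA
  isoB := S.isometry_pauliB
  comm := fun ⟨t, i⟩ ⟨t', j⟩ => by
    rw [pauliA_eq, pauliB_eq]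
    exact S.commute_aliceDilated_bobDilated _ _ _ _ _ _
  close := fun ⟨t, i⟩ => by
    rw [pauliA_eq, pauliB_eq]
    exact dist_aliceDilated_bobDilated hε hS _ _ _

theorem dist_commutator_pauliA (hε : 0 ≤ ε) (hS : 1 - ε ≤ S.winProb) (t : Bool)
    (i j : Fin (2 * n)) :
    dist (S.pauliA (t, i) (S.pauliA (t, j) S.dilatedState))
      (S.pauliA (t, j) (S.pauliA (t, i) S.dilatedState)) ≤ 66 * √ε := by
  simp only [pauliA_eq]
  by_cases h : round i = round j
  -- Within a round, operators of the same type lie in one row, so in every branch they come from a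
  -- single measurement of Alice and commute exactly.
  · rw [h, commute_apply (S.commute_aliceDilated _ _ _ _), dist_self]
    positivity
  · exact dist_commutator_aliceDilated hε hS _ _ _ _ _ _ fun h' => absurd h' h

/-- On one qubit, Z and X lie in different rows and columns and anticommute. On the two qubits of
one round they share a column, so one question to Bob covers both and they commute. -/
theorem dist_pauliA_ZX (hε : 0 ≤ ε) (hS : 1 - ε ≤ S.winProb) (i j : Fin (2 * n)) :
    dist (S.pauliA (false, i) (S.pauliA (true, j) S.dilatedState))
      (sgn (if j = i then 1 else 0) •
        S.pauliA (true, j) (S.pauliA (false, i) S.dilatedState)) ≤ 66 * √ε := by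
  simp only [pauliA_eq]
  split_ifs with h
  · subst h
    rw [sgn_one, neg_one_smul]
    refine dist_anticommutator_aliceDilated hε hS ?_ _
    by_cases h : j.val % 2 = 0 <;> simp [pauliCol, h]
  · rw [sgn_zero, one_smul]
    refine dist_commutator_aliceDilated hε hS _ _ _ _ _ _ fun h' => ?_
    have h1 : i.val / 2 = j.val / 2 := congrArg Fin.val h'
    have h2 : j.val ≠ i.val := fun h2 => h (Fin.ext h2)
    by_cases hi : i.val % 2 = 0 <;> by_cases hj : j.val % 2 = 0
    · omega
    · simp [pauliCol, hi, hj]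
    · simp [pauliCol, hi, hj]
    · omega

theorem eprFidelity_bound (hε : 0 ≤ ε) (hS : 1 - ε ≤ S.winProb) :
    1 - 1200 * (n : ℝ) ^ 2 * √ε ≤ S.eprFidelity := by
  have hδ : (0 : ℝ) ≤ √ε := Real.sqrt_nonneg ε
  let T : Qubits n → Qubits n → Dilated n H := fun a g =>
    powWord (fun i => S.pauliB (false, i)) (List.finRange (2 * n)).reverse g
      (powWord (fun i => S.pauliA (true, i)) (List.finRange (2 * n)) a S.dilatedState)
  let χ : Output n H := synth fun a b d e => sgn (d ⬝ᵥ (b + e)) • T (a + d) (b + e)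
  have hχ : actOnOutput (eprProj n) χ = χ :=
    actOnOutput_eprProj_of_supported
      (fun c f => ((2 : ℂ) ^ (4 * n))⁻¹ • ∑ g, sgn (g ⬝ᵥ f) • T (c + f) g)
      (fun u c v f => synth_pauli T u c v f)
  obtain ⟨h0, h1⟩ := le_inner_actOnOutput eprProj_isHermitian eprProj_mul_self S.outputState χ hχ
  have hnorm : ‖S.outputState‖ = 1 := by
    rw [outputState, (AddMonoidHomClass.isometry_iff_norm _).1 S.isometry_V, norm_dilatedState]
  have hn : (n : ℝ) ≤ (n : ℝ) ^ 2 := by exact_mod_cast Nat.le_self_pow two_ne_zero n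
  have hdist : ‖S.outputState - χ‖ ^ 2 ≤ (1200 * (n : ℝ) ^ 2 * √ε) ^ 2 := by
    rw [outputState, V_apply, synth_sub]
    refine norm_synth_sq_le _ fun a b d e => ?_
    refine pow_le_pow_left₀ (norm_nonneg _) ?_ 2
    have := (matched_pauli hε hS).pauli_mul (κ := 66 * √ε) (fun l => by
        rw [show l = (l.1, l.2) from rfl, pauliA_eq]
        exact S.aliceDilated_mul_self _ _ _) (by positivity)
      (dist_commutator_pauliA hε hS) (dist_pauliA_ZX hε hS) a b d e
    rw [dist_eq_norm] at this
    simp only [Pi.sub_apply, WA_eq, WB_eq, mul_apply_eq_comp]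
    -- With `m = 2 * n`, `δ = 6 * √ε` and `κ = 66 * √ε` the error is `36 * n * √ε + 1080 * n ^ 2 *
    -- √ε`.
    refine this.trans ?_
    push_cast
    nlinarith [mul_le_mul_of_nonneg_right hn hδ]
  rw [hnorm] at h1
  change _ ≤ (inner ℂ S.outputState (actOnOutput (eprProj n) S.outputState)).re
  have hη : 0 ≤ 1200 * (n : ℝ) ^ 2 * √ε := by positivity
  -- The loss of fidelity is at most the square of this error, hence at most the error when that is
  -- below 1; otherwise nonnegativity of the fidelity suffices.
  by_cases hle : 1200 * (n : ℝ) ^ 2 * √ε ≤ 1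
  · nlinarith
  · linarith

end Strategy
end MagicSquare

end

theorem mainTheorem3 :
    (∃ C : ℝ, 0 < C ∧
      ∀ (n : ℕ) (ε : ℝ), 0 ≤ ε →
        ∀ (H : Type*) [NormedAddCommGroup H] [InnerProductSpace ℂ H] [CompleteSpace H]
          (S : MagicSquare.Strategy n H), 1 - ε ≤ S.winProb →
            Isometry S.V ∧ 1 - C * (n : ℝ) ^ 2 * √ε ≤ S.eprFidelity) ∧
    (∀ n : ℕ,
      Module.End.eigenspace (Matrix.toLin' (MagicSquare.idealTest n)) 1 =
          Submodule.span ℂ {MagicSquare.eprState n} ∧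
        ∀ μ : ℂ, Module.End.HasEigenvalue (Matrix.toLin' (MagicSquare.idealTest n)) μ →
          μ ≠ 1 → ‖μ‖ ≤ 5 / 9) :=
  ⟨⟨1200, by norm_num, fun _ _ hε _ _ _ _ S hS =>
      ⟨S.isometry_V, MagicSquare.Strategy.eprFidelity_bound hε hS⟩⟩,
    fun n => ⟨MagicSquare.idealTest_eigenspace n, MagicSquare.idealTest_eigenvalue n⟩⟩
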